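/- Let $N\ge 1$, let $\mathbb T$ be the circle, identified with $[0,1)$, and let $\mathcal R=\mathcal D^N$ be the set of dyadic rectangles $R=R_1\times\cdots\times R_N$ of $\mathbb T^N$. For a dyadic interval $I$ put $h_I^0=h_I=|I|^{-1/2}(\chi_{I^+}-\chi_{I^-})$ ($I^\pm$ the right and left halves) and $h_I^1=\chi_I/|I|$; for $\vec\varepsilon\in\{0,1\}^N$ put $h_R^{\vec\varepsilon}(t)=\prod_j h_{R_j}^{\varepsilon_j}(t_j)$, $h_R=h_R^{\vec 0}$, $f_R=\langle f,h_R\rangle$. Let $L^2_0(\mathbb T^N)$ be the closed span in $L^2(\mathbb T^N)$ of the $h_R$, $R\in\mathcal R$, and $P_0$ the orthogonal projection of $L^2(\mathbb T^N)$ onto it. Inclusions of dyadic rectangles in open sets are understood up to null sets. * $\mathrm{BMO}^d(\mathbb T^N)$ is the space of $f\in L_0^2(\mathbb T^N)$ with $\|f\|_{\mathrm{BMO}^d}^2=\sup_{\Omega}\frac1{|\Omega|}\sum_{R\in\mathcal R,\,R\subseteq\Omega}|f_R|^2<\infty$, the supremum over the non-empty open sets $\Omega\subseteq\mathbb T^N$.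 * $\mathrm{bmo}^d(\mathbb T^N)$ is the space of $f\in L^2(\mathbb T^N)$ with $\|f\|_{\mathrm{bmo}^d}=\sup_{R\in\mathcal R}\frac1{|R|}\int_R|f-m_Rf|<\infty$, where $m_Rf=\frac1{|R|}\int_Rf$. * For $\vec\beta\in\{0,1\}^N$, $\mathrm{LMO}^d_{\vec\beta}(\mathbb T^N)$ is the space of $\varphi\in L^2(\mathbb T^N)$ with $$\|\varphi\|^2_{\mathrm{LMO}^d_{\vec\beta}}=\sup_{R\in\mathcal R}\ \sup_{\emptyset\ne\Omega\subseteq R\text{ open}}\frac{\big(\sum_{j=1}^N\log\frac4{|R_{\beta_j}|}\big)^2}{|\Omega|}\sum_{Q\in\mathcal R,\,Q\subseteq\Omega}|\varphi_Q|^2<\infty,$$ where $R_{\beta_j}=R_j$ if $\beta_j=0$ and $R_{\beta_j}=\mathbb T$ (of length $1$) if $\beta_j=1$. * The paraproduct is $\Pi^{\vec\beta}_\varphi f=\sum_{R\in\mathcal R}\langle\varphi,h_R\rangle\langle f,h_R^{\vec\delta}\rangle h_R^{\vec\beta}$, where $\delta_j=1-\beta_j$. **Theorem.** For every $N$ there is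 a constant $C$ depending only on $N$ such that for every $\vec\beta\in\{0,1\}^N$ with $\vec\beta\ne(0,\dots,0),(1,\dots,1)$ and every $\varphi\in\mathrm{LMO}^d_{\vec\beta}(\mathbb T^N)$, the operator $\Pi^{\vec\beta}_\varphi$ is bounded from $\mathrm{bmo}^d(\mathbb T^N)$ to $\mathrm{BMO}^d(\mathbb T^N)$, with norm at most $C\|\varphi\|_{\mathrm{LMO}^d_{\vec\beta}}$. Here $\Pi^{\vec\beta}_\varphi f$ is taken modulo functions orthogonal to all $h_R$; that is, for every $f\in\mathrm{bmo}^d(\mathbb T^N)$ the series defining $\Pi^{\vec\beta}_\varphi f$ converges unconditionally in $L^2(\mathbb T^N)$, $P_0\Pi^{\vec\beta}_\varphi f\in\mathrm{BMO}^d(\mathbb T^N)$, and $$\|P_0\Pi^{\vec\beta}_\varphi f\|_{\mathrm{BMO}^d}\le C\,\|\varphi\|_{\mathrm{LMO}^d_{\vec\beta}}\,\|f\|_{\mathrm{bmo}^d}.$$ -/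

import Mathlib

open MeasureTheory
open scoped ENNReal NNReal

/-- The `N`-torus, with the product of the normalized Haar measures of the circle `ℝ / ℤ`. -/
abbrev Torus (N : ℕ) : Type := Fin N → UnitAddCircle

/-- `L²(𝕋^N)`, complex valued. -/
abbrev L2Torus (N : ℕ) : Type := Lp ℂ 2 (volume : Measure (Torus N))

/-- A dyadic interval `[k 2⁻ʲ, (k+1) 2⁻ʲ)` of `𝕋 ≃ [0,1)`, indexed by its generation `j` and its
position `k ∈ {0, …, 2ʲ - 1}`. -/
structure DyadicInterval where
  gen : ℕ
  pos : Fin (2 ^ gen)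

namespace DyadicInterval

/-- The length `|I| = 2⁻ʲ`. -/
noncomputable def length (I : DyadicInterval) : ℝ := ((2 : ℝ) ^ I.gen)⁻¹

/-- The left end point of `I` in `[0,1)`. -/
noncomputable def left (I : DyadicInterval) : ℝ := ((I.pos : ℕ) : ℝ) * I.length

/-- The image in the circle of a half-open interval of the real line. -/
def arc (a b : ℝ) : Set UnitAddCircle := (fun x : ℝ => (x : UnitAddCircle)) '' Set.Ico a b

/-- The set of points of `I`. -/
def toSet (I : DyadicInterval) : Set UnitAddCircle := arc I.left (I.left + I.length)

/-- The left half `I⁻`. -/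
def leftHalf (I : DyadicInterval) : Set UnitAddCircle := arc I.left (I.left + I.length / 2)

/-- The right half `I⁺`. -/
def rightHalf (I : DyadicInterval) : Set UnitAddCircle :=
  arc (I.left + I.length / 2) (I.left + I.length)

/-- The Haar function `h_I = |I|^{-1/2} (χ_{I⁺} - χ_{I⁻})`. -/
noncomputable def haar (I : DyadicInterval) (t : UnitAddCircle) : ℝ :=
  (Real.sqrt I.length)⁻¹ *
    (I.rightHalf.indicator (fun _ => (1 : ℝ)) t - I.leftHalf.indicator (fun _ => (1 : ℝ)) t)

/-- `h_I^ε`, that is `h_I` if `ε = 0` and `|I|^{-1/2} |h_I| = χ_I / |I|` if `ε = 1`. -/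
noncomputable def haarE (ε : Fin 2) (I : DyadicInterval) (t : UnitAddCircle) : ℝ :=
  if ε = 0 then I.haar t else (Real.sqrt I.length)⁻¹ * |I.haar t|

theorem measurableSet_arc (a b : ℝ) : MeasurableSet (arc a b) := by
  rcases le_or_gt b a with h | h
  · simp [arc, Set.Ico_eq_empty (not_lt.mpr h)]
  · have : arc a b = insert (a : UnitAddCircle)
        ((fun x : ℝ => (x : UnitAddCircle)) '' Set.Ioo a b) := by
      rw [arc, ← Set.Ioo_insert_left h, Set.image_insert_eq]
    rw [this]
    exact ((QuotientAddGroup.isOpenMap_coe _ isOpen_Ioo).measurableSet).insert _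

theorem measurable_haarE (ε : Fin 2) (I : DyadicInterval) : Measurable (I.haarE ε) := by
  have h : Measurable I.haar :=
    ((measurable_const.indicator (measurableSet_arc _ _)).sub
      (measurable_const.indicator (measurableSet_arc _ _))).const_mul _
  unfold haarE
  split_ifs
  · exact h
  · exact (h.abs).const_mul _

theorem exists_abs_haarE_le (ε : Fin 2) (I : DyadicInterval) :
    ∃ M : ℝ, 0 ≤ M ∧ ∀ t, |I.haarE ε t| ≤ M := by
  have hs : 0 ≤ (Real.sqrt I.length)⁻¹ := by positivity
  have key : ∀ t, |I.haar t| ≤ (Real.sqrt I.length)⁻¹ * 2 := by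
    intro t
    unfold haar
    rw [abs_mul, abs_of_nonneg hs]
    refine mul_le_mul_of_nonneg_left ?_ hs
    by_cases h1 : t ∈ I.rightHalf <;> by_cases h2 : t ∈ I.leftHalf <;> simp [h1, h2]
  refine ⟨max ((Real.sqrt I.length)⁻¹ * 2) ((Real.sqrt I.length)⁻¹ * ((Real.sqrt I.length)⁻¹ * 2)),
    le_max_of_le_left (by positivity), fun t => ?_⟩
  unfold haarE
  split_ifs
  · exact (key t).trans (le_max_left _ _)
  · rw [abs_mul, abs_abs, abs_of_nonneg hs]
    exact (mul_le_mul_of_nonneg_left (key t) hs).trans (le_max_right _ _)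

end DyadicInterval

/-- A dyadic rectangle `R = R₁ × ⋯ × R_N`. -/
abbrev DyadicRect (N : ℕ) : Type := Fin N → DyadicInterval

namespace DyadicRect

variable {N : ℕ}

/-- The set of points of `R`. -/
def toSet (R : DyadicRect N) : Set (Torus N) := Set.pi Set.univ fun j => (R j).toSet

/-- The function `h_R^ε(t) = h_{R₁}^{ε₁}(t₁) ⋯ h_{R_N}^{ε_N}(t_N)`. -/
noncomputable def haarFun (ε : Fin N → Fin 2) (R : DyadicRect N) (t : Torus N) : ℂ :=
  ∏ j, (((R j).haarE (ε j) (t j) : ℝ) : ℂ)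

theorem memLp_haarFun (ε : Fin N → Fin 2) (R : DyadicRect N) :
    MemLp (haarFun ε R) 2 (volume : Measure (Torus N)) := by
  choose M hM0 hM using fun j => DyadicInterval.exists_abs_haarE_le (ε j) (R j)
  refine MemLp.of_bound ?_ (∏ j, M j) (Filter.Eventually.of_forall fun t => ?_)
  · refine Measurable.aestronglyMeasurable ?_
    unfold haarFun
    exact Finset.measurable_prod _ fun j _ => Complex.measurable_ofReal.comp
      ((DyadicInterval.measurable_haarE (ε j) (R j)).comp (measurable_pi_apply j))
  · rw [haarFun, norm_prod]
    refine Finset.prod_le_prod (fun j _ => norm_nonneg _) fun j _ => ?_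
    rw [Complex.norm_real]
    exact hM j (t j)

/-- `h_R^ε` as an element of `L²(𝕋^N)`. -/
noncomputable def haarLp (ε : Fin N → Fin 2) (R : DyadicRect N) : L2Torus N :=
  (memLp_haarFun ε R).toLp (haarFun ε R)

/-- The number `⟨f, h_R^ε⟩ = ∫ f h_R^ε`. (Mathlib's inner product is linear in the second
argument, and `h_R^ε` is real valued.) -/
noncomputable def coeff (ε : Fin N → Fin 2) (f : L2Torus N) (R : DyadicRect N) : ℂ :=
  inner ℂ (haarLp ε R) f

/-- `R ⊆ Ω` up to a set of measure zero. (Whether the end points belong to a dyadic interval plays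
no role.) -/
def InsideAE (R : DyadicRect N) (Ω : Set (Torus N)) : Prop := volume (R.toSet \ Ω) = 0

end DyadicRect

section Spaces

variable {N : ℕ}

/-- `∑_{R ⊆ Ω} |f_R|²` over the dyadic rectangles `R`, where `f_R = ⟨f, h_R⟩`. -/
noncomputable def haarEnergy (f : L2Torus N) (Ω : Set (Torus N)) : ℝ≥0∞ :=
  ∑' R : {R : DyadicRect N // R.InsideAE Ω}, ‖DyadicRect.coeff 0 f R.1‖ₑ ^ 2

/-- `L²₀(𝕋^N)`, the closed linear span of the Haar functions `h_R`. -/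
noncomputable def L20 (N : ℕ) : Submodule ℂ (L2Torus N) :=
  (Submodule.span ℂ (Set.range fun R : DyadicRect N => DyadicRect.haarLp 0 R)).topologicalClosure

noncomputable instance instCompleteSpaceL20 (N : ℕ) : CompleteSpace (L20 N) := by
  unfold L20; infer_instance

/-- The product norm: `‖f‖²_{BMO^d}` is the supremum of `|Ω|⁻¹ ∑_{R ⊆ Ω} |f_R|²` over the open
sets `Ω`. -/
noncomputable def BMOdNorm (f : L2Torus N) : ℝ≥0∞ :=
  (⨆ (Ω : Set (Torus N)) (_ : IsOpen Ω), (volume Ω)⁻¹ * haarEnergy f Ω) ^ (1 / 2 : ℝ)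

/-- The dyadic product space `BMO^d(𝕋^N)`. -/
def BMOd (N : ℕ) : Set (L2Torus N) := {f | f ∈ L20 N ∧ BMOdNorm f < ∞}

/-- The little norm: the supremum over the dyadic rectangles `R` of `|R|⁻¹ ∫_R |f - m_R f|`. -/
noncomputable def bmodNorm (f : L2Torus N) : ℝ≥0∞ :=
  ⨆ R : DyadicRect N,
    (volume R.toSet)⁻¹ * ∫⁻ t in R.toSet, ‖f t - ⨍ s in R.toSet, f s‖ₑ

/-- The dyadic little space `bmo^d(𝕋^N)`. -/
def bmod (N : ℕ) : Set (L2Torus N) := {f | bmodNorm f < ∞}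

/-- `∑_j log (4 / |R_{δ_j}|)`, where `R_{δ_j}` is `R_j` if `δ_j = 0` and `𝕋` (of length `1`)
otherwise. -/
noncomputable def logWeight (δ : Fin N → Fin 2) (R : DyadicRect N) : ℝ :=
  ∑ j, Real.log (4 / (if δ j = 0 then (R j).length else 1))

/-- `‖φ‖²_{LMO_δ^d}` is the least `C` such that
`(∑_j log (4 / |R_{δ_j}|))² / |Ω| * ∑_{Q ⊆ Ω} |φ_Q|² ≤ C`
for all dyadic rectangles `R` and all open sets `Ω ⊆ R`. -/
noncomputable def LMOdNorm (δ : Fin N → Fin 2) (φ : L2Torus N) : ℝ≥0∞ :=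
  (⨆ (R : DyadicRect N) (Ω : Set (Torus N)) (_ : IsOpen Ω) (_ : Ω ⊆ R.toSet),
    ENNReal.ofReal (logWeight δ R) ^ 2 * (volume Ω)⁻¹ * haarEnergy φ Ω) ^ (1 / 2 : ℝ)

/-- The space `LMO_δ^d(𝕋^N)`. -/
def LMOd (δ : Fin N → Fin 2) : Set (L2Torus N) := {φ | LMOdNorm δ φ < ∞}

/-- The terms `⟨φ, h_R^ε⟩ ⟨f, h_R^δ⟩ h_R^β` of the bilinear operator `B_{ε,δ,β}(φ, f)`. -/
noncomputable def BTerm (ε δ β : Fin N → Fin 2) (φ f : L2Torus N) (R : DyadicRect N) :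
    L2Torus N :=
  (DyadicRect.coeff ε φ R * DyadicRect.coeff δ f R) • DyadicRect.haarLp β R

/-- The terms of the paraproduct `Π^β_φ f`: here `ε = 0`, and `δ_j = 1` if `β_j = 0`, `δ_j = 0`
otherwise. -/
noncomputable def paraproductTerm (β : Fin N → Fin 2) (φ f : L2Torus N) (R : DyadicRect N) :
    L2Torus N :=
  BTerm 0 (fun j => if β j = 0 then 1 else 0) β φ f R

/-- The paraproduct `Π^β_φ f`, as an (unconditional) sum in `L²(𝕋^N)` over all dyadic
rectangles. -/
noncomputable def paraproduct (β : Fin N → Fin 2) (φ f : L2Torus N) : L2Torus N :=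
  ∑' R : DyadicRect N, paraproductTerm β φ f R

end Spaces

/-!
The paraproduct is controlled through an embedding inequality (`DyadicRect.sum_coeff_sq_mul_le`): if
`β` takes the value `1` somewhere and `B` is the little norm of `f`, then
`∑_R |⟨f, h_R^δ⟩|² |⟨g, h_R^β⟩|² ≤ 13 · 4^N · B² ‖g‖²` for all `g ∈ L²`. By duality, a partial sum of
the paraproduct over a set of rectangles has squared norm at most `13 · 4^N · B²` times the sum of
`|φ_R|²` over these rectangles. This yields the unconditional convergence. Moreover `h_R^β` and
`h_Q` are orthogonal unless `R ⊆ Q`, so the coefficients of the paraproduct at the `Q ⊆ Ω` only see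
the terms with `R ⊆ Ω`, and Bessel's inequality bounds their energy by that of `φ` in `Ω`. The energy
of `φ` is used only through its product norm, that is, through `R = 𝕋^N` in the definition of the
logarithmic norm: the variables in which `f` is averaged cost nothing, because averages of `f` in
some of the variables still have mean oscillations at most `B` in the others.

The embedding inequality involves finitely many rectangles at a time, so `f` and `g` may be replaced
by their averages over the cells of a fine grid, and the variables can be removed one by one
(`DyadicGrid.sum_gridCoeff_sq_mul_le`). A variable in which `f` is averaged and `g` is paired with
Haar functions is removed by Bessel's inequality. When only variables of the other kind are left, `g`
may be taken nonnegative, and its averages over the intervals of one variable are dominated by its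
dyadic maximal function in that variable, which is bounded on `L²`; the energy of `f` in that
variable is then integrated over the slices of `f`, whose oscillations are again at most `B`. In the
last variable, the John–Nirenberg inequality (`DyadicTree.treeSum_jump_sq_le`) shows that the energy
of `f` is a Carleson sequence, and the Carleson embedding theorem applies.

The inequalities in one variable are proved on the dyadic tree. Each follows from a function `Φ` of
the node whose average over the two children exceeds its value at the node by at least the summand
to be controlled (`DyadicTree.sum_levelAvg_add_le`).
-/

/-! ### Inequalities on the dyadic tree -/

namespace DyadicInterval

/-- The left child of a dyadic interval. -/
def lo (I : DyadicInterval) : DyadicInterval :=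
  ⟨I.gen + 1, ⟨2 * I.pos, by have := I.pos.2; rw [pow_succ]; omega⟩⟩

/-- The right child of a dyadic interval. -/
def hi (I : DyadicInterval) : DyadicInterval :=
  ⟨I.gen + 1, ⟨2 * I.pos + 1, by have := I.pos.2; rw [pow_succ]; omega⟩⟩

@[simp] theorem lo_gen (I : DyadicInterval) : I.lo.gen = I.gen + 1 := rfl
@[simp] theorem hi_gen (I : DyadicInterval) : I.hi.gen = I.gen + 1 := rfl

/-- The dyadic interval of length one. -/
def root : DyadicInterval := ⟨0, ⟨0, by norm_num⟩⟩

end DyadicInterval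

namespace DyadicTree

open DyadicInterval

/-- The average of `φ` over the dyadic intervals of generation `l`. -/
noncomputable def levelAvg (l : ℕ) (φ : DyadicInterval → ℝ) : ℝ :=
  ((2 : ℝ) ^ l)⁻¹ * ∑ p : Fin (2 ^ l), φ ⟨l, p⟩

theorem levelAvg_zero (φ : DyadicInterval → ℝ) : levelAvg 0 φ = φ root := by
  simp [levelAvg, root]

theorem sum_fin_two_pow_succ (l : ℕ) (g : Fin (2 ^ (l + 1)) → ℝ) :
    ∑ p, g p = ∑ p : Fin (2 ^ l),
      (g ⟨2 * p, by have := p.2; rw [pow_succ]; omega⟩ +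
        g ⟨2 * p + 1, by have := p.2; rw [pow_succ]; omega⟩) := by
  have h : 2 ^ l * 2 = 2 ^ (l + 1) := (pow_succ 2 l).symm
  rw [← Equiv.sum_comp (finProdFinEquiv.trans (finCongr h)) g, Fintype.sum_prod_type]
  refine Finset.sum_congr rfl fun p _ => ?_
  rw [Fin.sum_univ_two]
  congr 2 <;> (ext; simp [finProdFinEquiv]; try omega)

theorem levelAvg_succ (l : ℕ) (φ : DyadicInterval → ℝ) :
    levelAvg (l + 1) φ = levelAvg l fun I => (φ I.lo + φ I.hi) / 2 := by
  unfold levelAvg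
  rw [sum_fin_two_pow_succ, ← Finset.sum_div, pow_succ, mul_inv, mul_assoc]
  congr 1
  rw [div_eq_inv_mul]
  rfl

theorem levelAvg_mono {l : ℕ} {φ ψ : DyadicInterval → ℝ} (h : ∀ I, I.gen = l → φ I ≤ ψ I) :
    levelAvg l φ ≤ levelAvg l ψ := by
  unfold levelAvg
  gcongr with p
  exact h _ rfl

theorem levelAvg_add (l : ℕ) (φ ψ : DyadicInterval → ℝ) :
    levelAvg l (fun I => φ I + ψ I) = levelAvg l φ + levelAvg l ψ := by
  simp [levelAvg, Finset.sum_add_distrib, mul_add]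

/-- Summation over the tree: if `Φ` increases by at least `c` when averaged over the children, then
the total of `c` over the generations below `n` is at most the growth of `Φ`. -/
theorem sum_levelAvg_add_le {n : ℕ} {c Φ : DyadicInterval → ℝ}
    (h : ∀ I, I.gen < n → c I + Φ I ≤ (Φ I.lo + Φ I.hi) / 2) :
    ∑ l ∈ Finset.range n, levelAvg l c + Φ root ≤ levelAvg n Φ := by
  induction n with
  | zero => simp [levelAvg_zero]
  | succ n ih =>
    have h1 := ih fun I hI => h I (by omega)
    have h2 : levelAvg n c + levelAvg n Φ ≤ levelAvg (n + 1) Φ := by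
      rw [levelAvg_succ, ← levelAvg_add]
      exact levelAvg_mono fun I hI => h I (by omega)
    rw [Finset.sum_range_succ]
    linarith

/-- The values `m I` behave, up to generation `n`, as the averages of a function over dyadic
intervals: each is the mean of the values at the two children. -/
def IsMart {E : Type*} [AddCommGroup E] [Module ℝ E] (n : ℕ) (m : DyadicInterval → E) : Prop :=
  ∀ I : DyadicInterval, I.gen < n → m I = (2⁻¹ : ℝ) • (m I.lo + m I.hi)

/-- The jump of `m` at `I`: half the difference of the values at the two children. -/
noncomputable def jump {E : Type*} [AddCommGroup E] [Module ℝ E] (m : DyadicInterval → E)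
    (I : DyadicInterval) : E := (2⁻¹ : ℝ) • (m I.hi - m I.lo)

theorem IsMart.norm_sub_sq {n : ℕ} {m : DyadicInterval → ℂ} (hm : IsMart n m) {I : DyadicInterval}
    (hI : I.gen < n) (c : ℂ) :
    ‖jump m I‖ ^ 2 + ‖m I - c‖ ^ 2 = (‖m I.lo - c‖ ^ 2 + ‖m I.hi - c‖ ^ 2) / 2 := by
  have h := parallelogram_law_with_norm ℝ (m I.hi - c) (m I.lo - c)
  have h1 : jump m I = (2⁻¹ : ℝ) • ((m I.hi - c) - (m I.lo - c)) := by
    simp [jump]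
  have h2 : m I - c = (2⁻¹ : ℝ) • ((m I.hi - c) + (m I.lo - c)) := by
    rw [hm I hI]
    simp only [Complex.real_smul]; push_cast; ring
  rw [h1, h2, norm_smul, norm_smul, mul_pow, mul_pow]
  have h3 : ‖(2⁻¹ : ℝ)‖ = 2⁻¹ := by norm_num
  rw [h3]
  linarith

theorem IsMart.norm_sq {n : ℕ} {m : DyadicInterval → ℂ} (hm : IsMart n m) {I : DyadicInterval}
    (hI : I.gen < n) :
    ‖jump m I‖ ^ 2 + ‖m I‖ ^ 2 = (‖m I.lo‖ ^ 2 + ‖m I.hi‖ ^ 2) / 2 := by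
  simpa using hm.norm_sub_sq hI 0

theorem sum_jump_sq_le {n : ℕ} {m : DyadicInterval → ℂ} (hm : IsMart n m) :
    ∑ l ∈ Finset.range n, levelAvg l (fun I => ‖jump m I‖ ^ 2) ≤
      levelAvg n fun I => ‖m I‖ ^ 2 := by
  have := sum_levelAvg_add_le (n := n) (c := fun I => ‖jump m I‖ ^ 2) (Φ := fun I => ‖m I‖ ^ 2)
    fun I hI => (hm.norm_sq hI).le
  nlinarith [sq_nonneg ‖m root‖]

/-- Recursive form of `runMax`. -/
noncomputable def runMaxAux (f : DyadicInterval → ℝ) : (l : ℕ) → Fin (2 ^ l) → ℝ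
  | 0, p => f ⟨0, p⟩
  | l + 1, p => max (runMaxAux f l ⟨p / 2, by
        have h := p.2; have := pow_succ 2 l; omega⟩)
      (f ⟨l + 1, p⟩)

/-- The dyadic maximal function: the maximum of `f` over the dyadic intervals containing `I`. -/
noncomputable def runMax (f : DyadicInterval → ℝ) (I : DyadicInterval) : ℝ :=
  runMaxAux f I.gen I.pos

theorem runMax_root (f : DyadicInterval → ℝ) : runMax f root = f root := rfl

theorem runMax_lo (f : DyadicInterval → ℝ) (I : DyadicInterval) :
    runMax f I.lo = max (runMax f I) (f I.lo) := by
  simp only [runMax, lo, runMaxAux]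
  congr 2
  ext
  simp

theorem runMax_hi (f : DyadicInterval → ℝ) (I : DyadicInterval) :
    runMax f I.hi = max (runMax f I) (f I.hi) := by
  simp only [runMax, hi, runMaxAux]
  congr 2
  ext
  simp only
  omega

theorem le_runMax (f : DyadicInterval → ℝ) (I : DyadicInterval) : f I ≤ runMax f I := by
  obtain ⟨l, p⟩ := I
  cases l with
  | zero => exact le_rfl
  | succ l => exact le_max_right _ _

theorem runMax_sum_le {ι : Type*} (s : Finset ι) (w : ι → ℝ) (hw : ∀ i ∈ s, 0 ≤ w i)
    (f : ι → DyadicInterval → ℝ) (I : DyadicInterval) :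
    runMax (fun J => ∑ i ∈ s, w i * f i J) I ≤ ∑ i ∈ s, w i * runMax (f i) I := by
  obtain ⟨l, p⟩ := I
  unfold runMax
  induction l with
  | zero => exact le_rfl
  | succ l ih =>
    simp only [runMaxAux]
    refine max_le ((ih _).trans ?_) ?_
    · exact Finset.sum_le_sum fun i hi => mul_le_mul_of_nonneg_left (le_max_left _ _) (hw i hi)
    · exact Finset.sum_le_sum fun i hi => mul_le_mul_of_nonneg_left (le_max_right _ _) (hw i hi)

/-- The dyadic maximal function has norm at most `2` on `L²`. The potential `4 L f - 2 L²`, with `L`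
the running maximum of `f`, does not decrease on average, and it starts from a nonnegative value. -/
theorem levelAvg_runMax_sq_le {n : ℕ} {f : DyadicInterval → ℝ} (hf : IsMart n f) :
    levelAvg n (fun I => runMax f I ^ 2) ≤ 4 * levelAvg n fun I => f I ^ 2 := by
  have h := sum_levelAvg_add_le (n := n) (c := fun _ => 0)
    (Φ := fun I => 4 * runMax f I * f I - 2 * runMax f I ^ 2) fun I hI => by
      have hm := hf I hI
      simp only [smul_eq_mul] at hm
      have key : ∀ L x : ℝ, 4 * L * x - 2 * L ^ 2 ≤ 4 * max L x * x - 2 * max L x ^ 2 := by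
        intro L x
        rcases le_total L x with hx | hx
        · rw [max_eq_right hx]; nlinarith [sq_nonneg (L - x)]
        · rw [max_eq_left hx]
      rw [runMax_lo, runMax_hi]
      have h1 := key (runMax f I) (f I.lo)
      have h2 := key (runMax f I) (f I.hi)
      rw [hm] at *
      linarith
  have h0 : ∑ l ∈ Finset.range n, levelAvg l (fun _ => (0 : ℝ)) = 0 := by simp [levelAvg]
  rw [h0, runMax_root] at h
  have h3 : levelAvg n (fun I => 4 * runMax f I * f I - 2 * runMax f I ^ 2) ≤
      levelAvg n (fun I => 4 * f I ^ 2 + -runMax f I ^ 2) :=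
    levelAvg_mono fun I _ => by nlinarith [sq_nonneg (runMax f I - 2 * f I)]
  rw [levelAvg_add] at h3
  have h4 : levelAvg n (fun I => 4 * f I ^ 2) = 4 * levelAvg n (fun I => f I ^ 2) := by
    simp only [levelAvg, ← Finset.mul_sum]; ring
  have h5 : levelAvg n (fun I => -runMax f I ^ 2) = -levelAvg n (fun I => runMax f I ^ 2) := by
    simp only [levelAvg, Finset.sum_neg_distrib]; ring
  rw [h4, h5] at h3
  nlinarith [sq_nonneg (f root)]

/-- The square function of `m`, weighted by the averages `f ≥ 0`, is controlled by `|m|²` weighted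
by the maximal function of `f`. -/
theorem sum_jump_sq_mul_le {n : ℕ} {m : DyadicInterval → ℂ} (hm : IsMart n m)
    {f : DyadicInterval → ℝ} (hf : ∀ I, 0 ≤ f I) :
    ∑ l ∈ Finset.range n, levelAvg l (fun I => ‖jump m I‖ ^ 2 * f I ^ 2) ≤
      levelAvg n fun I => ‖m I‖ ^ 2 * runMax f I ^ 2 := by
  have h := sum_levelAvg_add_le (n := n) (c := fun I => ‖jump m I‖ ^ 2 * f I ^ 2)
    (Φ := fun I => ‖m I‖ ^ 2 * runMax f I ^ 2) fun I hI => by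
      have h0 := hm.norm_sq hI
      have hL := le_runMax f I
      have hfI := hf I
      rw [runMax_lo, runMax_hi]
      have h1 : ‖jump m I‖ ^ 2 * f I ^ 2 ≤ ‖jump m I‖ ^ 2 * runMax f I ^ 2 := by gcongr
      have hLL : 0 ≤ runMax f I := hfI.trans hL
      have h2 : ‖m I.lo‖ ^ 2 * runMax f I ^ 2 ≤
          ‖m I.lo‖ ^ 2 * max (runMax f I) (f I.lo) ^ 2 := by
        gcongr; exact le_max_left _ _
      have h3 : ‖m I.hi‖ ^ 2 * runMax f I ^ 2 ≤
          ‖m I.hi‖ ^ 2 * max (runMax f I) (f I.hi) ^ 2 := by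
        gcongr; exact le_max_left _ _
      have h4 : (‖jump m I‖ ^ 2 + ‖m I‖ ^ 2) * runMax f I ^ 2 =
        (‖m I.lo‖ ^ 2 + ‖m I.hi‖ ^ 2) / 2 * runMax f I ^ 2 := by rw [h0]
      linarith
  have : 0 ≤ ‖m root‖ ^ 2 * runMax f root ^ 2 := by positivity
  linarith

/-- The sum of `|K| c(K) / |I|` over the intervals `K ⊆ I` of the `k` generations that start with
that of `I`. -/
noncomputable def treeSum (c : DyadicInterval → ℝ) : ℕ → DyadicInterval → ℝ
  | 0, _ => 0
  | k + 1, I => c I + (treeSum c k I.lo + treeSum c k I.hi) / 2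

theorem treeSum_nonneg {c : DyadicInterval → ℝ} (hc : ∀ I, 0 ≤ c I) (k : ℕ) (I : DyadicInterval) :
    0 ≤ treeSum c k I := by
  induction k generalizing I with
  | zero => exact le_rfl
  | succ k ih =>
    have h1 := ih I.lo
    have h2 := ih I.hi
    have h3 := hc I
    simp only [treeSum]
    positivity

/-- The Carleson embedding theorem on the dyadic tree. -/
theorem carleson_embedding {n : ℕ} {c f : DyadicInterval → ℝ} (hc : ∀ I, 0 ≤ c I)
    (hf : ∀ I, 0 ≤ f I) {K : ℝ} (hK : ∀ I, I.gen ≤ n → treeSum c (n - I.gen) I ≤ K) :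
    ∑ l ∈ Finset.range n, levelAvg l (fun I => c I * f I ^ 2) ≤
      K * levelAvg n fun I => runMax f I ^ 2 := by
  have h := sum_levelAvg_add_le (n := n) (c := fun I => c I * f I ^ 2)
    (Φ := fun I => (K - treeSum c (n - I.gen) I) * runMax f I ^ 2) fun I hI => by
      have hlo := hK I.lo hI
      have hhi := hK I.hi hI
      obtain ⟨k, hk⟩ : ∃ k, n - I.gen = k + 1 := ⟨n - I.gen - 1, by omega⟩
      have hk1 : n - I.lo.gen = k := by simp; omega
      have hk2 : n - I.hi.gen = k := by simp; omega
      rw [hk1] at hlo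
      rw [hk2] at hhi
      simp only [hk, hk1, hk2, treeSum, runMax_lo, runMax_hi]
      have hL := le_runMax f I
      have hfI := hf I
      have hLL : 0 ≤ runMax f I := hfI.trans hL
      have h1 : c I * f I ^ 2 ≤ c I * runMax f I ^ 2 := by
        have := hc I
        gcongr
      have h2 : (K - treeSum c k I.lo) * runMax f I ^ 2 ≤
          (K - treeSum c k I.lo) * max (runMax f I) (f I.lo) ^ 2 := by
        have : 0 ≤ K - treeSum c k I.lo := by linarith
        gcongr; exact le_max_left _ _
      have h3 : (K - treeSum c k I.hi) * runMax f I ^ 2 ≤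
          (K - treeSum c k I.hi) * max (runMax f I) (f I.hi) ^ 2 := by
        have : 0 ≤ K - treeSum c k I.hi := by linarith
        gcongr; exact le_max_left _ _
      linarith
  have h0 : 0 ≤ (K - treeSum c (n - root.gen) root) * runMax f root ^ 2 :=
    mul_nonneg (by linarith [hK root (Nat.zero_le _)]) (sq_nonneg _)
  have h1 : levelAvg n (fun I => (K - treeSum c (n - I.gen) I) * runMax f I ^ 2) ≤
      levelAvg n (fun I => K * runMax f I ^ 2) := levelAvg_mono fun I _ => by
    have := treeSum_nonneg hc (n - I.gen) I
    gcongr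
    linarith
  have h2 : levelAvg n (fun I => K * runMax f I ^ 2) = K * levelAvg n fun I => runMax f I ^ 2 := by
    simp only [levelAvg, ← Finset.mul_sum]; ring
  linarith

/-- The John–Nirenberg inequality in its `L²` form: if the mean oscillations of a function with
averages `m` are at most `B`, then the energy of its jumps is a Carleson sequence. Here `P c I`
stands for the average over `I` of the distance of the function to the constant `c`. -/
theorem treeSum_jump_sq_le {n : ℕ} {m : DyadicInterval → ℂ} (hm : IsMart n m)
    {P : ℂ → DyadicInterval → ℝ} (hP : ∀ c, IsMart n (P c))
    (hmP : ∀ c I, I.gen ≤ n → ‖m I - c‖ ≤ P c I) {B : ℝ} (hB : 0 ≤ B)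
    (hosc : ∀ I, I.gen ≤ n → P (m I) I ≤ B) (I : DyadicInterval) (hI : I.gen ≤ n) :
    treeSum (fun J => ‖jump m J‖ ^ 2) (n - I.gen) I ≤ 13 * B ^ 2 := by
  have hjump : ∀ K : DyadicInterval, K.gen < n → ‖m K.lo - m K‖ ≤ B ∧ ‖m K.hi - m K‖ ≤ B := by
    intro K hK
    have h1 := hmP (m K) K.lo hK
    have h2 := hmP (m K) K.hi hK
    have h3 := hP (m K) K hK
    have h4 := hosc K hK.le
    have h5 : m K.hi - m K = -(m K.lo - m K) := by
      have := hm K hK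
      simp only [Complex.real_smul] at this
      push_cast at this
      linear_combination -2 * this
    have h6 : ‖m K.hi - m K‖ = ‖m K.lo - m K‖ := by rw [h5, norm_neg]
    simp only [smul_eq_mul] at h3
    constructor <;> linarith
  obtain ⟨k, hk⟩ : ∃ k, n - I.gen = k := ⟨_, rfl⟩
  induction k using Nat.strong_induction_on generalizing I with
  | _ k ih =>
  -- The estimate for the descendants of `I`, with the mean `m I` as the reference constant; a
  -- descendant with `2B < |m K - m I|` is stopped, and the induction hypothesis applies to it.
  have inner : ∀ (j : ℕ) (K : DyadicInterval), K.gen ≤ n → n - K.gen = j → j < k →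
      ‖m K - m I‖ ≤ 3 * B →
      treeSum (fun J => ‖jump m J‖ ^ 2) j K + ‖m K - m I‖ ^ 2 ≤ 4 * B ^ 2 + 9 * B * P (m I) K := by
    intro j
    induction j with
    | zero =>
      intro K hK hj hjk hz
      have hp := hmP (m I) K hK
      have hn := norm_nonneg (m K - m I)
      simp only [treeSum]
      nlinarith
    | succ j ihj =>
      intro K hK hj hjk hz
      have hp := hmP (m I) K hK
      have hn := norm_nonneg (m K - m I)
      rcases le_or_gt ‖m K - m I‖ (2 * B) with hs | hs
      · have hKn : K.gen < n := by omega
        obtain ⟨hl, hh⟩ := hjump K hKn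
        have tl : ‖m K.lo - m I‖ ≤ 3 * B := by
          have := norm_add_le (m K.lo - m K) (m K - m I)
          rw [sub_add_sub_cancel] at this
          linarith
        have th : ‖m K.hi - m I‖ ≤ 3 * B := by
          have := norm_add_le (m K.hi - m K) (m K - m I)
          rw [sub_add_sub_cancel] at this
          linarith
        have el := ihj K.lo hKn (by simp; omega) (by omega) tl
        have eh := ihj K.hi hKn (by simp; omega) (by omega) th
        have e := hm.norm_sub_sq hKn (m I)
        have eP := hP (m I) K hKn
        simp only [smul_eq_mul] at eP
        simp only [treeSum]
        rw [eP]
        linarith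
      · have hV := ih (j + 1) hjk K hK hj
        rw [hj] at hV
        nlinarith
  cases k with
  | zero =>
    rw [hk]
    simp only [treeSum]
    positivity
  | succ k =>
    have hIn : I.gen < n := by omega
    obtain ⟨hl, hh⟩ := hjump I hIn
    have el := inner k I.lo hIn (by simp; omega) (by omega) (by linarith)
    have eh := inner k I.hi hIn (by simp; omega) (by omega) (by linarith)
    have e := hm.norm_sub_sq hIn (m I)
    have eP := hP (m I) I hIn
    have hp := hosc I hI
    simp only [smul_eq_mul] at eP
    rw [sub_self, norm_zero] at e
    rw [hk]
    simp only [treeSum]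
    nlinarith

end DyadicTree

/-! ### Dyadic intervals and Haar functions on the circle -/

/-- The representative in `[0,1)` of a point of the circle. -/
noncomputable def circleRep (t : UnitAddCircle) : ℝ := (AddCircle.equivIco (1 : ℝ) 0 t : ℝ)

theorem circleRep_nonneg (t : UnitAddCircle) : 0 ≤ circleRep t :=
  (AddCircle.equivIco (1 : ℝ) 0 t).2.1

theorem circleRep_lt_one (t : UnitAddCircle) : circleRep t < 1 := by
  exact (AddCircle.equivIco (1 : ℝ) 0 t).2.2.trans_eq (zero_add 1)

theorem coe_circleRep (t : UnitAddCircle) : ((circleRep t : ℝ) : UnitAddCircle) = t :=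
  AddCircle.coe_equivIco

theorem circleRep_coe {x : ℝ} (h0 : 0 ≤ x) (h1 : x < 1) :
    circleRep (x : UnitAddCircle) = x :=
  AddCircle.equivIco_coe_of_mem (p := (1 : ℝ)) (a := 0) ⟨h0, by simpa using h1⟩

/-- The position of the dyadic interval of generation `n` that contains `t`. -/
noncomputable def dyadicPos (n : ℕ) (t : UnitAddCircle) : ℕ := ⌊(2 : ℝ) ^ n * circleRep t⌋₊

theorem dyadicPos_lt (n : ℕ) (t : UnitAddCircle) : dyadicPos n t < 2 ^ n := by
  unfold dyadicPos
  rw [Nat.floor_lt (mul_nonneg (by positivity) (circleRep_nonneg t))]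
  push_cast
  have := circleRep_lt_one t
  have h2 : (0 : ℝ) < 2 ^ n := by positivity
  nlinarith

theorem dyadicPos_succ_div (n : ℕ) (t : UnitAddCircle) :
    dyadicPos (n + 1) t / 2 = dyadicPos n t := by
  unfold dyadicPos
  rw [← Nat.floor_div_ofNat]
  congr 1
  rw [pow_succ]
  ring

theorem dyadicPos_congr {m n : ℕ} (hmn : m ≤ n) {s t : UnitAddCircle}
    (h : dyadicPos n s = dyadicPos n t) : dyadicPos m s = dyadicPos m t := by
  induction n, hmn using Nat.le_induction with
  | base => exact h
  | succ n _ ih => exact ih (by rw [← dyadicPos_succ_div, h, dyadicPos_succ_div])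

/-- The left end point of the `q`-th dyadic interval of generation `n`, as a point of the circle. -/
noncomputable def dyadicPt (n : ℕ) (q : Fin (2 ^ n)) : UnitAddCircle :=
  (((q : ℕ) : ℝ) / 2 ^ n : ℝ)

theorem dyadicPos_dyadicPt (n : ℕ) (q : Fin (2 ^ n)) : dyadicPos n (dyadicPt n q) = q := by
  have h2 : (0 : ℝ) < 2 ^ n := by positivity
  have hq : ((q : ℕ) : ℝ) < 2 ^ n := by exact_mod_cast q.2
  unfold dyadicPos dyadicPt
  rw [circleRep_coe (by positivity) (by rwa [div_lt_one h2]), mul_div_cancel₀ _ h2.ne']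
  exact Nat.floor_natCast _

namespace DyadicInterval

theorem mem_arc_iff {a b : ℝ} (ha : 0 ≤ a) (hb : b ≤ 1) (t : UnitAddCircle) :
    t ∈ arc a b ↔ circleRep t ∈ Set.Ico a b := by
  constructor
  · rintro ⟨x, hx, rfl⟩
    simp only
    rwa [circleRep_coe (ha.trans hx.1) (hx.2.trans_le hb)]
  · exact fun h => ⟨_, h, coe_circleRep t⟩

theorem length_pos (I : DyadicInterval) : 0 < I.length := by unfold length; positivity

theorem left_nonneg (I : DyadicInterval) : 0 ≤ I.left :=
  mul_nonneg (Nat.cast_nonneg _) I.length_pos.le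

theorem left_add_length (I : DyadicInterval) :
    I.left + I.length = (((I.pos : ℕ) : ℝ) + 1) * I.length := by unfold left; ring

theorem left_add_length_le (I : DyadicInterval) : I.left + I.length ≤ 1 := by
  rw [left_add_length]
  have h : (((I.pos : ℕ) : ℝ) + 1) ≤ 2 ^ I.gen := by exact_mod_cast I.pos.2
  unfold length
  rw [← div_eq_mul_inv, div_le_one (by positivity)]
  exact h

theorem mem_toSet_iff (I : DyadicInterval) (t : UnitAddCircle) :
    t ∈ I.toSet ↔ dyadicPos I.gen t = I.pos := by
  have h2 : (0 : ℝ) < 2 ^ I.gen := by positivity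
  unfold toSet
  rw [mem_arc_iff I.left_nonneg I.left_add_length_le, left_add_length, dyadicPos,
    Nat.floor_eq_iff (mul_nonneg h2.le (circleRep_nonneg t)), Set.mem_Ico, left, length,
    ← div_eq_mul_inv, ← div_eq_mul_inv, div_le_iff₀ h2, lt_div_iff₀ h2, mul_comm (circleRep t)]

theorem lo_length (I : DyadicInterval) : I.lo.length = I.length / 2 := by
  simp only [length, lo_gen, pow_succ, mul_inv]; ring

theorem hi_length (I : DyadicInterval) : I.hi.length = I.length / 2 := by
  simp only [length, hi_gen, pow_succ, mul_inv]; ring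

theorem leftHalf_eq (I : DyadicInterval) : I.leftHalf = I.lo.toSet := by
  have h : I.lo.left = I.left := by
    simp only [left, lo_length]; simp [lo]; ring
  rw [leftHalf, toSet, h, lo_length]

theorem rightHalf_eq (I : DyadicInterval) : I.rightHalf = I.hi.toSet := by
  have h : I.hi.left = I.left + I.length / 2 := by
    simp only [left, hi_length]; simp [hi]; ring
  rw [rightHalf, toSet, h, hi_length, add_assoc, add_halves]

theorem mem_lo_toSet_iff (I : DyadicInterval) (t : UnitAddCircle) :
    t ∈ I.lo.toSet ↔ dyadicPos (I.gen + 1) t = 2 * I.pos := mem_toSet_iff _ _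

theorem mem_hi_toSet_iff (I : DyadicInterval) (t : UnitAddCircle) :
    t ∈ I.hi.toSet ↔ dyadicPos (I.gen + 1) t = 2 * I.pos + 1 := mem_toSet_iff _ _

theorem lo_subset (I : DyadicInterval) : I.lo.toSet ⊆ I.toSet := fun t ht => by
  rw [mem_lo_toSet_iff] at ht
  rw [mem_toSet_iff, ← dyadicPos_succ_div]
  omega

theorem hi_subset (I : DyadicInterval) : I.hi.toSet ⊆ I.toSet := fun t ht => by
  rw [mem_hi_toSet_iff] at ht
  rw [mem_toSet_iff, ← dyadicPos_succ_div]
  omega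

theorem not_mem_hi_of_mem_lo {I : DyadicInterval} {t : UnitAddCircle} (h : t ∈ I.lo.toSet) :
    t ∉ I.hi.toSet := by
  rw [mem_lo_toSet_iff] at h
  rw [mem_hi_toSet_iff]
  omega

theorem mem_lo_or_hi {I : DyadicInterval} {t : UnitAddCircle} (h : t ∈ I.toSet) :
    t ∈ I.lo.toSet ∨ t ∈ I.hi.toSet := by
  rw [mem_toSet_iff, ← dyadicPos_succ_div] at h
  rw [mem_lo_toSet_iff, mem_hi_toSet_iff]
  omega

theorem haar_eq (I : DyadicInterval) (t : UnitAddCircle) :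
    I.haar t = (Real.sqrt I.length)⁻¹ * (I.hi.toSet.indicator (fun _ => (1 : ℝ)) t -
      I.lo.toSet.indicator (fun _ => (1 : ℝ)) t) := by
  rw [haar, leftHalf_eq, rightHalf_eq]

theorem haarE_one (I : DyadicInterval) (t : UnitAddCircle) :
    I.haarE 1 t = I.toSet.indicator (fun _ => I.length⁻¹) t := by
  have hs : (Real.sqrt I.length)⁻¹ * (Real.sqrt I.length)⁻¹ = I.length⁻¹ := by
    rw [← mul_inv, Real.mul_self_sqrt I.length_pos.le]
  have hp : 0 ≤ (Real.sqrt I.length)⁻¹ := by positivity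
  rw [haarE, if_neg (by decide), haar_eq, abs_mul, abs_of_nonneg hp, ← mul_assoc, hs]
  by_cases h : t ∈ I.toSet
  · rcases mem_lo_or_hi h with h1 | h1
    · simp [h, h1, not_mem_hi_of_mem_lo h1]
    · have h2 : t ∉ I.lo.toSet := fun h2 => not_mem_hi_of_mem_lo h2 h1
      simp [h, h1, h2]
  · have h1 : t ∉ I.lo.toSet := fun h1 => h (I.lo_subset h1)
    have h2 : t ∉ I.hi.toSet := fun h1 => h (I.hi_subset h1)
    simp [h, h1, h2]

theorem haarE_one_nonneg (I : DyadicInterval) (t : UnitAddCircle) : 0 ≤ I.haarE 1 t := by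
  rw [haarE_one]
  exact Set.indicator_nonneg (fun _ _ => inv_nonneg.2 I.length_pos.le) t

theorem haarE_zero (I : DyadicInterval) (t : UnitAddCircle) :
    I.haarE 0 t = Real.sqrt I.length * (2⁻¹ * (I.hi.haarE 1 t - I.lo.haarE 1 t)) := by
  have hs : (Real.sqrt I.length)⁻¹ = Real.sqrt I.length * I.length⁻¹ := by
    rw [eq_comm, ← div_eq_mul_inv, div_eq_iff I.length_pos.ne']
    rw [inv_mul_eq_div, Real.div_sqrt]
  have h3 : (I.length / 2)⁻¹ = 2 * I.length⁻¹ := by rw [inv_div, div_eq_mul_inv]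
  rw [haarE_one, haarE_one, lo_length, hi_length, haarE, if_pos rfl, haar_eq, hs, h3]
  by_cases h1 : t ∈ I.lo.toSet <;> by_cases h2 : t ∈ I.hi.toSet <;> simp [h1, h2]

theorem haarE_one_eq_avg (I : DyadicInterval) (t : UnitAddCircle) :
    I.haarE 1 t = 2⁻¹ * (I.lo.haarE 1 t + I.hi.haarE 1 t) := by
  have h3 : (I.length / 2)⁻¹ = 2 * I.length⁻¹ := by rw [inv_div, div_eq_mul_inv]
  rw [haarE_one, haarE_one, haarE_one, lo_length, hi_length, h3]
  by_cases h : t ∈ I.toSet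
  · rcases mem_lo_or_hi h with h1 | h1
    · simp [h, h1, not_mem_hi_of_mem_lo h1]
    · have h2 : t ∉ I.lo.toSet := fun h2 => not_mem_hi_of_mem_lo h2 h1
      simp [h, h1, h2]
  · have h1 : t ∉ I.lo.toSet := fun h1 => h (I.lo_subset h1)
    have h2 : t ∉ I.hi.toSet := fun h1 => h (I.hi_subset h1)
    simp [h, h1, h2]

theorem haarE_eq_zero {ε : Fin 2} {I : DyadicInterval} {t : UnitAddCircle} (h : t ∉ I.toSet) :
    I.haarE ε t = 0 := by
  have h1 : t ∉ I.lo.toSet := fun h1 => h (I.lo_subset h1)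
  have h2 : t ∉ I.hi.toSet := fun h1 => h (I.hi_subset h1)
  have h3 : I.haar t = 0 := by simp [haar_eq, h1, h2]
  simp [haarE, h3]

theorem haarE_one_congr {I : DyadicInterval} {n : ℕ} (hn : I.gen ≤ n) {s t : UnitAddCircle}
    (h : dyadicPos n s = dyadicPos n t) : I.haarE 1 s = I.haarE 1 t := by
  rw [haarE_one, haarE_one]
  have : s ∈ I.toSet ↔ t ∈ I.toSet := by
    rw [mem_toSet_iff, mem_toSet_iff, dyadicPos_congr hn h]
  by_cases ht : t ∈ I.toSet
  · simp [ht, this.2 ht]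
  · simp [ht, mt this.1 ht]

/-- The functions `h_I^ε` are constant on the dyadic intervals of every later generation; averages
are also constant on intervals of the same generation, which is what `1 - ε` accounts for. -/
theorem haarE_congr (ε : Fin 2) {I : DyadicInterval} {n : ℕ} (hn : I.gen + (1 - ε : ℕ) ≤ n)
    {s t : UnitAddCircle} (h : dyadicPos n s = dyadicPos n t) : I.haarE ε s = I.haarE ε t := by
  fin_cases ε
  · have h1 : I.hi.gen ≤ n := by simpa using hn
    have h2 : I.lo.gen ≤ n := by simpa using hn
    change I.haarE 0 s = I.haarE 0 t
    rw [haarE_zero, haarE_zero, haarE_one_congr h1 h, haarE_one_congr h2 h]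
  · exact haarE_one_congr (by simpa using hn) h

/-- Expansion of `h_I^ε` in the indicators of the dyadic intervals of a later generation. -/
theorem haarE_eq_sum (ε : Fin 2) {I : DyadicInterval} {n : ℕ} (hn : I.gen + (1 - ε : ℕ) ≤ n)
    (t : UnitAddCircle) :
    I.haarE ε t = ∑ q : Fin (2 ^ n),
      (((2 : ℝ) ^ n)⁻¹ * I.haarE ε (dyadicPt n q)) * haarE 1 ⟨n, q⟩ t := by
  rw [Finset.sum_eq_single ⟨dyadicPos n t, dyadicPos_lt n t⟩]
  · have h1 : t ∈ toSet ⟨n, ⟨dyadicPos n t, dyadicPos_lt n t⟩⟩ := by rw [mem_toSet_iff]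
    rw [haarE_one, Set.indicator_of_mem h1, length, inv_inv,
      haarE_congr ε hn (dyadicPos_dyadicPt n ⟨dyadicPos n t, dyadicPos_lt n t⟩)]
    have : (2 : ℝ) ^ n ≠ 0 := by positivity
    field_simp
  · intro q _ hq
    rw [haarE_eq_zero (ε := 1), mul_zero]
    rw [mem_toSet_iff]
    intro h
    exact hq (Fin.ext h.symm)
  · simp

theorem measurableSet_toSet (I : DyadicInterval) : MeasurableSet I.toSet := measurableSet_arc _ _

theorem volume_toSet (I : DyadicInterval) : volume I.toSet = ENNReal.ofReal I.length := by
  have h := (UnitAddCircle.measurePreserving_mk 0).measure_preimage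
    I.measurableSet_toSet.nullMeasurableSet
  rw [← h, zero_add, Measure.restrict_congr_set Ico_ae_eq_Ioc.symm,
    Measure.restrict_apply' measurableSet_Ico]
  have : ((fun x : ℝ => (x : UnitAddCircle)) ⁻¹' I.toSet) ∩ Set.Ico (0 : ℝ) 1 =
      Set.Ico I.left (I.left + I.length) := by
    ext x
    constructor
    · rintro ⟨h1, h2⟩
      have h3 := (mem_arc_iff I.left_nonneg I.left_add_length_le _).1 h1
      rwa [circleRep_coe h2.1 h2.2] at h3
    · intro h1
      exact ⟨⟨x, h1, rfl⟩, I.left_nonneg.trans h1.1, h1.2.trans_le I.left_add_length_le⟩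
  rw [this, Real.volume_Ico]
  congr 1
  ring

theorem integrable_haarE (ε : Fin 2) (I : DyadicInterval) :
    Integrable (I.haarE ε) (volume : Measure UnitAddCircle) := by
  obtain ⟨M, _, hM⟩ := exists_abs_haarE_le ε I
  exact Integrable.of_bound (measurable_haarE ε I).aestronglyMeasurable M
    (Filter.Eventually.of_forall hM)

theorem integral_haarE_one (I : DyadicInterval) : ∫ t, I.haarE 1 t = 1 := by
  have h : I.haarE 1 = I.toSet.indicator (fun _ => I.length⁻¹) := funext I.haarE_one
  rw [h, integral_indicator I.measurableSet_toSet, setIntegral_const, measureReal_def,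
    volume_toSet, ENNReal.toReal_ofReal I.length_pos.le, smul_eq_mul,
    mul_inv_cancel₀ I.length_pos.ne']

theorem integral_haarE_zero (I : DyadicInterval) : ∫ t, I.haarE 0 t = 0 := by
  simp_rw [haarE_zero]
  rw [integral_const_mul, integral_const_mul,
    integral_sub (integrable_haarE _ _) (integrable_haarE _ _), integral_haarE_one,
    integral_haarE_one]
  simp

/-- The pairing `∫ h_I^ε h_J^ε'` on the circle. -/
noncomputable def pairing (ε : Fin 2) (I : DyadicInterval) (ε' : Fin 2) (J : DyadicInterval) : ℝ :=
  ∫ t, I.haarE ε t * J.haarE ε' t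

theorem pairing_comm (ε : Fin 2) (I : DyadicInterval) (ε' : Fin 2) (J : DyadicInterval) :
    pairing ε I ε' J = pairing ε' J ε I := by
  simp only [pairing, mul_comm]

/-- If `J` is shorter than `I`, then `h_I^ε` is constant on `J`. -/
theorem pairing_eq_of_gen_le {ε : Fin 2} {I : DyadicInterval} (ε' : Fin 2) {J : DyadicInterval}
    (h : I.gen + (1 - ε : ℕ) ≤ J.gen) :
    pairing ε I ε' J = I.haarE ε (dyadicPt J.gen J.pos) * ∫ t, J.haarE ε' t := by
  unfold pairing
  rw [← integral_const_mul]
  congr 1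
  ext t
  by_cases ht : t ∈ J.toSet
  · rw [mem_toSet_iff] at ht
    rw [haarE_congr ε h (ht.trans (dyadicPos_dyadicPt _ _).symm)]
  · rw [haarE_eq_zero ht, mul_zero, mul_zero]

theorem eq_of_gen_of_mem {I J : DyadicInterval} (h : I.gen = J.gen) {t : UnitAddCircle}
    (hI : t ∈ I.toSet) (hJ : t ∈ J.toSet) : I = J := by
  obtain ⟨i, p⟩ := I
  obtain ⟨j, q⟩ := J
  simp only at h
  subst h
  rw [mem_toSet_iff] at hI hJ
  simp only at hI hJ
  have : p = q := Fin.ext (hI.symm.trans hJ)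
  rw [this]

theorem pairing_eq_zero_of_gen_eq {ε ε' : Fin 2} {I J : DyadicInterval} (h : I.gen = J.gen)
    (hne : I ≠ J) : pairing ε I ε' J = 0 := by
  unfold pairing
  have : ∀ t, I.haarE ε t * J.haarE ε' t = 0 := fun t => by
    by_cases hI : t ∈ I.toSet
    · rw [haarE_eq_zero (fun hJ => hne (eq_of_gen_of_mem h hI hJ)), mul_zero]
    · rw [haarE_eq_zero hI, zero_mul]
  simp [this]

theorem pairing_zero_zero_of_ne {I J : DyadicInterval} (hne : I ≠ J) : pairing 0 I 0 J = 0 := by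
  rcases lt_trichotomy I.gen J.gen with h | h | h
  · rw [pairing_eq_of_gen_le 0 (by simpa using h), integral_haarE_zero, mul_zero]
  · exact pairing_eq_zero_of_gen_eq h hne
  · rw [pairing_comm, pairing_eq_of_gen_le 0 (by simpa using h), integral_haarE_zero, mul_zero]

theorem pairing_one_one_self (I : DyadicInterval) : pairing 1 I 1 I = I.length⁻¹ := by
  rw [pairing_eq_of_gen_le 1 (by simp), integral_haarE_one, mul_one, haarE_one,
    Set.indicator_of_mem]
  rw [mem_toSet_iff, dyadicPos_dyadicPt]

theorem pairing_zero_zero_self (I : DyadicInterval) : pairing 0 I 0 I = 1 := by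
  have h : ∀ t, I.haarE 0 t * I.haarE 0 t = I.haarE 1 t := by
    intro t
    have hs : (Real.sqrt I.length)⁻¹ * (Real.sqrt I.length)⁻¹ = I.length⁻¹ := by
      rw [← mul_inv, Real.mul_self_sqrt I.length_pos.le]
    by_cases ht : t ∈ I.toSet
    · rw [haarE_one, Set.indicator_of_mem ht, ← hs, haarE, if_pos rfl, haar_eq]
      rcases mem_lo_or_hi ht with h1 | h1
      · simp [h1, not_mem_hi_of_mem_lo h1]
      · have h2 : t ∉ I.lo.toSet := fun h2 => not_mem_hi_of_mem_lo h2 h1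
        simp [h1, h2]
    · simp [haarE_eq_zero ht]
  simp only [pairing, h, integral_haarE_one]

/-- If `h_I^1` and `h_J` are not orthogonal, then `I` is contained in `J`. -/
theorem subset_of_pairing_one_zero_ne {I J : DyadicInterval} (h : pairing 1 I 0 J ≠ 0) :
    I.toSet ⊆ J.toSet := by
  rcases le_or_gt I.gen J.gen with hg | hg
  · rw [pairing_eq_of_gen_le 0 (by simpa using hg), integral_haarE_zero, mul_zero] at h
    exact absurd rfl h
  · rw [pairing_comm, pairing_eq_of_gen_le 1 (by simpa using hg)] at h
    have h1 : dyadicPt I.gen I.pos ∈ J.toSet := by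
      by_contra hc
      exact h (by rw [haarE_eq_zero hc, zero_mul])
    intro t ht
    rw [mem_toSet_iff] at ht h1 ⊢
    rw [dyadicPos_congr hg.le (ht.trans (dyadicPos_dyadicPt _ _).symm), h1]

theorem subset_of_pairing_zero_ne {ε : Fin 2} {I J : DyadicInterval} (h : pairing ε I 0 J ≠ 0) :
    I.toSet ⊆ J.toSet := by
  fin_cases ε
  · rw [not_imp_comm.1 pairing_zero_zero_of_ne h]
  · exact subset_of_pairing_one_zero_ne h

end DyadicInterval

/-! ### The embedding inequality on a grid -/

namespace DyadicGrid

open DyadicInterval DyadicTree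

variable {E : Type*} [AddCommGroup E] [Module ℝ E]

/-- The cells of the grid of generation `n` on the circle. -/
abbrev Cell (n : ℕ) : Type := Fin (2 ^ n)

/-- The dyadic intervals of generation less than `n`. -/
abbrev Node (n : ℕ) : Type := Σ l : Fin n, Fin (2 ^ (l : ℕ))

/-- A node as a dyadic interval. -/
def Node.toInterval {n : ℕ} (x : Node n) : DyadicInterval := ⟨x.1, x.2⟩

theorem Node.gen_lt {n : ℕ} (x : Node n) : x.toInterval.gen < n := x.1.2

theorem Node.toInterval_injective {n : ℕ} :
    Function.Injective (Node.toInterval : Node n → DyadicInterval) := by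
  rintro ⟨⟨l, hl⟩, p⟩ ⟨⟨l', hl'⟩, p'⟩ h
  simp only [Node.toInterval, DyadicInterval.mk.injEq] at h
  obtain ⟨h1, h2⟩ := h
  subst h1
  rw [eq_of_heq h2]

/-- The integral of `h_I^ε` over the cell `q`, when `h_I^ε` is constant on the cells. -/
noncomputable def kernel (n : ℕ) (ε : Fin 2) (I : DyadicInterval) (q : Cell n) : ℝ :=
  ((2 : ℝ) ^ n)⁻¹ * I.haarE ε (dyadicPt n q)

/-- The pairing with `h_I^ε` of the function with value `u q` on the cell `q`. -/
noncomputable def cellCoeff (n : ℕ) (ε : Fin 2) (I : DyadicInterval) (u : Cell n → E) : E :=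
  ∑ q, kernel n ε I q • u q

theorem kernel_one_nonneg (n : ℕ) (I : DyadicInterval) (q : Cell n) : 0 ≤ kernel n 1 I q :=
  mul_nonneg (by positivity) (haarE_one_nonneg _ _)

theorem cellCoeff_nonneg {n : ℕ} {I : DyadicInterval} {v : Cell n → ℝ} (h : ∀ q, 0 ≤ v q) :
    0 ≤ cellCoeff n 1 I v :=
  Finset.sum_nonneg fun q _ => mul_nonneg (kernel_one_nonneg n I q) (h q)

theorem sum_kernel_one {n : ℕ} {I : DyadicInterval} (hI : I.gen ≤ n) :
    ∑ q, kernel n 1 I q = 1 := by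
  have h := I.integral_haarE_one
  rw [funext fun t => haarE_eq_sum 1 (n := n) (by simpa using hI) t, integral_finsetSum _
    fun q _ => (integrable_haarE _ _).const_mul _] at h
  simpa [integral_const_mul, integral_haarE_one, kernel] using h

theorem norm_cellCoeff_le {n : ℕ} {I : DyadicInterval} (u : Cell n → ℂ) :
    ‖cellCoeff n 1 I u‖ ≤ cellCoeff n 1 I fun q => ‖u q‖ := by
  refine (norm_sum_le _ _).trans_eq (Finset.sum_congr rfl fun q _ => ?_)
  rw [norm_smul, Real.norm_of_nonneg (kernel_one_nonneg n I q), smul_eq_mul]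

theorem norm_cellCoeff_sub_le {n : ℕ} {I : DyadicInterval} (hI : I.gen ≤ n) (u : Cell n → ℂ)
    (c : ℂ) : ‖cellCoeff n 1 I u - c‖ ≤ cellCoeff n 1 I fun q => ‖u q - c‖ := by
  have h : cellCoeff n 1 I u - c = cellCoeff n 1 I fun q => u q - c := by
    simp only [cellCoeff, smul_sub, Finset.sum_sub_distrib, ← Finset.sum_smul, sum_kernel_one hI,
      one_smul]
  rw [h]
  exact norm_cellCoeff_le _

theorem isMart_cellCoeff (n m : ℕ) (u : Cell n → E) :
    IsMart m fun I => cellCoeff n 1 I u := by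
  intro I _
  simp only [cellCoeff, ← Finset.sum_add_distrib, Finset.smul_sum, ← add_smul, smul_smul]
  refine Finset.sum_congr rfl fun q _ => ?_
  congr 1
  simp only [kernel]
  rw [haarE_one_eq_avg]
  ring

theorem cellCoeff_zero_eq (n : ℕ) (I : DyadicInterval) (u : Cell n → E) :
    cellCoeff n 0 I u = Real.sqrt I.length • jump (fun J => cellCoeff n 1 J u) I := by
  simp only [cellCoeff, jump, ← Finset.sum_sub_distrib, Finset.smul_sum, ← sub_smul, smul_smul]
  refine Finset.sum_congr rfl fun q _ => ?_
  congr 1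
  simp only [kernel]
  rw [haarE_zero]
  ring

theorem norm_sq_cellCoeff_zero (n : ℕ) (I : DyadicInterval) (u : Cell n → ℂ) :
    ‖cellCoeff n 0 I u‖ ^ 2 = I.length * ‖jump (fun J => cellCoeff n 1 J u) I‖ ^ 2 := by
  rw [cellCoeff_zero_eq, norm_smul, mul_pow, Real.norm_of_nonneg (Real.sqrt_nonneg _),
    Real.sq_sqrt I.length_pos.le]

theorem kernel_cell (n : ℕ) (q r : Cell n) : kernel n 1 ⟨n, q⟩ r = if r = q then 1 else 0 := by
  have h : dyadicPt n r ∈ toSet ⟨n, q⟩ ↔ r = q := by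
    rw [mem_toSet_iff, dyadicPos_dyadicPt]
    exact Fin.ext_iff.symm
  rw [kernel, haarE_one]
  by_cases hr : r = q
  · rw [Set.indicator_of_mem (h.2 hr), if_pos hr, length, inv_inv, inv_mul_cancel₀ (by positivity)]
  · rw [Set.indicator_of_notMem (mt h.1 hr), if_neg hr, mul_zero]

theorem cellCoeff_cell (n : ℕ) (q : Cell n) (u : Cell n → E) : cellCoeff n 1 ⟨n, q⟩ u = u q := by
  simp [cellCoeff, kernel_cell]

theorem sum_node (n : ℕ) (c : DyadicInterval → ℝ) :
    ∑ x : Node n, x.toInterval.length * c x.toInterval =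
      ∑ l ∈ Finset.range n, levelAvg l c := by
  rw [Fintype.sum_sigma, ← Fin.sum_univ_eq_sum_range (fun l => levelAvg l c)]
  refine Finset.sum_congr rfl fun l _ => ?_
  rw [levelAvg, Finset.mul_sum]
  rfl

/-- Bessel's inequality in one variable. -/
theorem sum_norm_sq_cellCoeff_le (n : ℕ) (u : Cell n → ℂ) :
    ∑ x : Node n, ‖cellCoeff n 0 x.toInterval u‖ ^ 2 ≤ ((2 : ℝ) ^ n)⁻¹ * ∑ q, ‖u q‖ ^ 2 := by
  simp only [norm_sq_cellCoeff_zero]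
  rw [sum_node n fun I => ‖jump (fun J => cellCoeff n 1 J u) I‖ ^ 2]
  refine (sum_jump_sq_le (isMart_cellCoeff n n u)).trans_eq ?_
  simp only [levelAvg, cellCoeff_cell]

/-- The dyadic maximal function of the function with value `v q` on the cell `q`. -/
noncomputable def cellMax (n : ℕ) (v : Cell n → ℝ) (q : Cell n) : ℝ :=
  runMax (fun I => cellCoeff n 1 I v) ⟨n, q⟩

theorem le_cellMax (n : ℕ) (v : Cell n → ℝ) (q : Cell n) : v q ≤ cellMax n v q :=
  (cellCoeff_cell n q v).symm.trans_le (le_runMax (fun I => cellCoeff n 1 I v) ⟨n, q⟩)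

theorem sum_cellMax_sq_le (n : ℕ) (v : Cell n → ℝ) :
    ∑ q, cellMax n v q ^ 2 ≤ 4 * ∑ q, v q ^ 2 := by
  have h := levelAvg_runMax_sq_le (isMart_cellCoeff n n v)
  simp only [levelAvg, cellCoeff_cell] at h
  have h2 : (0 : ℝ) < ((2 : ℝ) ^ n)⁻¹ := by positivity
  refine le_of_mul_le_mul_left ?_ h2
  unfold cellMax
  linarith

theorem cellMax_sum_le {ι : Type*} (s : Finset ι) (w : ι → ℝ) (hw : ∀ i ∈ s, 0 ≤ w i) (n : ℕ)
    (v : ι → Cell n → ℝ) (q : Cell n) :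
    cellMax n (fun r => ∑ i ∈ s, w i * v i r) q ≤ ∑ i ∈ s, w i * cellMax n (v i) q := by
  have h : (fun I => cellCoeff n 1 I fun r => ∑ i ∈ s, w i * v i r) =
      fun I => ∑ i ∈ s, w i * cellCoeff n 1 I (v i) := by
    ext I
    simp only [cellCoeff, smul_eq_mul, Finset.mul_sum]
    rw [Finset.sum_comm]
    exact Finset.sum_congr rfl fun i _ => Finset.sum_congr rfl fun r _ => by ring
  unfold cellMax
  rw [h]
  exact runMax_sum_le s w hw _ _

theorem sum_cellCoeff_sq_mul_le (n : ℕ) (u : Cell n → ℂ) {v : Cell n → ℝ} (hv : ∀ q, 0 ≤ v q) :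
    ∑ x : Node n, ‖cellCoeff n 0 x.toInterval u‖ ^ 2 * cellCoeff n 1 x.toInterval v ^ 2 ≤
      ((2 : ℝ) ^ n)⁻¹ * ∑ q, ‖u q‖ ^ 2 * cellMax n v q ^ 2 := by
  simp only [norm_sq_cellCoeff_zero, mul_assoc]
  rw [sum_node n fun I => ‖jump (fun J => cellCoeff n 1 J u) I‖ ^ 2 * cellCoeff n 1 I v ^ 2]
  refine (sum_jump_sq_mul_le (isMart_cellCoeff n n u)
    (f := fun I => cellCoeff n 1 I v) fun I => cellCoeff_nonneg hv).trans_eq ?_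
  simp only [levelAvg, cellCoeff_cell, cellMax]

/-- The embedding inequality in one variable, for functions of bounded mean oscillation. -/
theorem sum_cellCoeff_sq_mul_le_of_osc {n : ℕ} {u : Cell n → ℂ} {B : ℝ} (hB : 0 ≤ B)
    (hu : ∀ I : DyadicInterval, I.gen ≤ n →
      cellCoeff n 1 I (fun q => ‖u q - cellCoeff n 1 I u‖) ≤ B)
    {v : Cell n → ℝ} (hv : ∀ q, 0 ≤ v q) :
    ∑ x : Node n, ‖cellCoeff n 0 x.toInterval u‖ ^ 2 * cellCoeff n 1 x.toInterval v ^ 2 ≤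
      13 * B ^ 2 * 4 * (((2 : ℝ) ^ n)⁻¹ * ∑ q, v q ^ 2) := by
  have hK := treeSum_jump_sq_le (isMart_cellCoeff n n u)
    (P := fun c I => cellCoeff n 1 I fun q => ‖u q - c‖) (fun c => isMart_cellCoeff n n _)
    (fun c I hI => norm_cellCoeff_sub_le hI u c) hB hu
  have h := carleson_embedding (f := fun I => cellCoeff n 1 I v)
    (fun I => sq_nonneg ‖jump (fun J => cellCoeff n 1 J u) I‖) (fun I => cellCoeff_nonneg hv) hK
  simp only [norm_sq_cellCoeff_zero, mul_assoc]
  rw [sum_node n fun I => ‖jump (fun J => cellCoeff n 1 J u) I‖ ^ 2 * cellCoeff n 1 I v ^ 2]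
  refine h.trans ?_
  have h1 := sum_cellMax_sq_le n v
  have h2 : (0 : ℝ) ≤ ((2 : ℝ) ^ n)⁻¹ := by positivity
  have h3 : levelAvg n (fun I => runMax (fun J => cellCoeff n 1 J v) I ^ 2) ≤
      4 * (((2 : ℝ) ^ n)⁻¹ * ∑ q, v q ^ 2) := by
    unfold levelAvg
    unfold cellMax at h1
    nlinarith
  calc _ ≤ 13 * B ^ 2 * (4 * (((2 : ℝ) ^ n)⁻¹ * ∑ q, v q ^ 2)) := by gcongr
    _ = _ := by ring

section Multi

variable {N : ℕ}

/-- The pairing with `h_R^ε` of the function with value `u Q` on the cell `Q` of the grid of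
generation `n` on the torus. -/
noncomputable def gridCoeff (n : ℕ) (ε : Fin N → Fin 2) (R : DyadicRect N)
    (u : (Fin N → Cell n) → E) : E :=
  ∑ Q : Fin N → Cell n, (∏ j, kernel n (ε j) (R j) (Q j)) • u Q

theorem sum_insertNth {M α : Type*} [AddCommMonoid M] [Fintype α] (p : Fin (N + 1))
    (F : (Fin (N + 1) → α) → M) :
    ∑ Q, F Q = ∑ x : α, ∑ Q' : Fin N → α, F (p.insertNth x Q') := by
  rw [← Equiv.sum_comp (Fin.insertNthEquiv (fun _ => α) p) F, Fintype.sum_prod_type]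
  rfl

/-- Pairing in the `p`-th variable last. -/
theorem gridCoeff_succ (n : ℕ) (p : Fin (N + 1)) (ε : Fin (N + 1) → Fin 2)
    (R : DyadicRect (N + 1)) (u : (Fin (N + 1) → Cell n) → E) :
    gridCoeff n ε R u = cellCoeff n (ε p) (R p) fun q =>
      gridCoeff n (fun j => ε (p.succAbove j)) (fun j => R (p.succAbove j))
        fun Q' => u (p.insertNth q Q') := by
  unfold gridCoeff cellCoeff
  rw [sum_insertNth p]
  simp only [Finset.smul_sum, smul_smul]
  refine Finset.sum_congr rfl fun q _ => Finset.sum_congr rfl fun Q' _ => ?_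
  rw [Fin.prod_univ_succAbove _ p]
  simp

/-- Pairing in the `p`-th variable first. -/
theorem gridCoeff_succ' (n : ℕ) (p : Fin (N + 1)) (ε : Fin (N + 1) → Fin 2)
    (R : DyadicRect (N + 1)) (u : (Fin (N + 1) → Cell n) → E) :
    gridCoeff n ε R u = gridCoeff n (fun j => ε (p.succAbove j)) (fun j => R (p.succAbove j))
      fun Q' => cellCoeff n (ε p) (R p) fun q => u (p.insertNth q Q') := by
  rw [gridCoeff_succ n p]
  unfold gridCoeff cellCoeff
  simp only [Finset.smul_sum, smul_smul]
  rw [Finset.sum_comm]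
  simp only [mul_comm]

theorem gridCoeff_mono {n : ℕ} {R : DyadicRect N} {v w : (Fin N → Cell n) → ℝ}
    (h : ∀ Q, v Q ≤ w Q) : gridCoeff n (fun _ => 1) R v ≤ gridCoeff n (fun _ => 1) R w :=
  Finset.sum_le_sum fun Q _ => mul_le_mul_of_nonneg_left (h Q)
    (Finset.prod_nonneg fun j _ => kernel_one_nonneg n (R j) (Q j))

theorem gridCoeff_nonneg {n : ℕ} {R : DyadicRect N} {v : (Fin N → Cell n) → ℝ}
    (h : ∀ Q, 0 ≤ v Q) : 0 ≤ gridCoeff n (fun _ => 1) R v :=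
  Finset.sum_nonneg fun Q _ => mul_nonneg
    (Finset.prod_nonneg fun j _ => kernel_one_nonneg n (R j) (Q j)) (h Q)

theorem norm_gridCoeff_le {n : ℕ} {R : DyadicRect N} (u : (Fin N → Cell n) → ℂ) :
    ‖gridCoeff n (fun _ => 1) R u‖ ≤ gridCoeff n (fun _ => 1) R fun Q => ‖u Q‖ := by
  refine (norm_sum_le _ _).trans_eq (Finset.sum_congr rfl fun Q _ => ?_)
  rw [norm_smul, Real.norm_of_nonneg
    (Finset.prod_nonneg fun j _ => kernel_one_nonneg n (R j) (Q j)), smul_eq_mul]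

/-- The mean oscillations of `u` over the dyadic rectangles with sides of generation at most `n`
are at most `B`. -/
def OscLe (n : ℕ) (B : ℝ) (u : (Fin N → Cell n) → ℂ) : Prop :=
  ∀ R : DyadicRect N, (∀ j, (R j).gen ≤ n) →
    gridCoeff n (fun _ => 1) R (fun Q => ‖u Q - gridCoeff n (fun _ => 1) R u‖) ≤ B

theorem forall_insertNth_gen_le {n : ℕ} {p : Fin (N + 1)} {I : DyadicInterval} (hI : I.gen ≤ n)
    {R : DyadicRect N} (hR : ∀ j, (R j).gen ≤ n) (j : Fin (N + 1)) :
    (p.insertNth (α := fun _ => DyadicInterval) I R j).gen ≤ n := by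
  induction j using Fin.succAboveCases p with
  | x => simpa using hI
  | p j => simpa using hR j

theorem OscLe.slice {n : ℕ} {B : ℝ} {u : (Fin (N + 1) → Cell n) → ℂ} (hu : OscLe n B u)
    (p : Fin (N + 1)) (q : Cell n) : OscLe n B fun Q' => u (p.insertNth q Q') := by
  intro R hR
  have h := hu (p.insertNth (α := fun _ => DyadicInterval) ⟨n, q⟩ R)
    (forall_insertNth_gen_le le_rfl hR)
  rw [gridCoeff_succ n p, gridCoeff_succ n p] at h
  simpa [cellCoeff_cell] using h

theorem OscLe.average {n : ℕ} {B : ℝ} {u : (Fin (N + 1) → Cell n) → ℂ} (hu : OscLe n B u)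
    (p : Fin (N + 1)) {I : DyadicInterval} (hI : I.gen ≤ n) :
    OscLe n B fun Q' => cellCoeff n 1 I fun q => u (p.insertNth q Q') := by
  intro R hR
  have h := hu (p.insertNth (α := fun _ => DyadicInterval) I R) (forall_insertNth_gen_le hI hR)
  rw [gridCoeff_succ' n p, gridCoeff_succ' n p] at h
  simp only [Fin.insertNth_apply_same, Fin.insertNth_apply_succAbove] at h
  exact (gridCoeff_mono fun Q' => norm_cellCoeff_sub_le hI _ _).trans h

/-- A rectangle whose sides are nodes. -/
def nodeRect {n : ℕ} (R : Fin N → Node n) : DyadicRect N := fun j => (R j).toInterval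

@[simp] theorem nodeRect_insertNth_same {n : ℕ} (p : Fin (N + 1)) (x : Node n)
    (R : Fin N → Node n) :
    nodeRect (p.insertNth (α := fun _ => Node n) x R) p = x.toInterval := by
  simp [nodeRect]

@[simp] theorem nodeRect_insertNth_succAbove {n : ℕ} (p : Fin (N + 1)) (x : Node n)
    (R : Fin N → Node n) (j : Fin N) :
    nodeRect (p.insertNth (α := fun _ => Node n) x R) (p.succAbove j) = nodeRect R j := by
  simp [nodeRect]

theorem gridCoeff_insertNth {n : ℕ} (p : Fin (N + 1)) (x : Node n) (R : Fin N → Node n)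
    (ε : Fin (N + 1) → Fin 2) (u : (Fin (N + 1) → Cell n) → E) :
    gridCoeff n ε (nodeRect (p.insertNth (α := fun _ => Node n) x R)) u =
      cellCoeff n (ε p) x.toInterval fun q =>
        gridCoeff n (fun j => ε (p.succAbove j)) (nodeRect R) fun Q' => u (p.insertNth q Q') := by
  rw [gridCoeff_succ n p]
  simp

theorem gridCoeff_insertNth' {n : ℕ} (p : Fin (N + 1)) (x : Node n) (R : Fin N → Node n)
    (ε : Fin (N + 1) → Fin 2) (u : (Fin (N + 1) → Cell n) → E) :
    gridCoeff n ε (nodeRect (p.insertNth (α := fun _ => Node n) x R)) u =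
      gridCoeff n (fun j => ε (p.succAbove j)) (nodeRect R) fun Q' =>
        cellCoeff n (ε p) x.toInterval fun q => u (p.insertNth q Q') := by
  rw [gridCoeff_succ' n p]
  simp

theorem gridCoeff_fin_zero {n : ℕ} (ε : Fin 0 → Fin 2) (R : DyadicRect 0)
    (u : (Fin 0 → Cell n) → E) (e : Fin 0 → Cell n) : gridCoeff n ε R u = u e := by
  rw [gridCoeff, Fintype.sum_subsingleton _ e]
  simp

theorem cellMax_gridCoeff_le {n : ℕ} (R : DyadicRect N) (v : Cell n → (Fin N → Cell n) → ℝ)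
    (q : Cell n) :
    cellMax n (fun r => gridCoeff n (fun _ => 1) R (v r)) q ≤
      gridCoeff n (fun _ => 1) R fun Q => cellMax n (fun r => v r Q) q :=
  cellMax_sum_le _ _ (fun Q _ => Finset.prod_nonneg fun j _ => kernel_one_nonneg n (R j) (Q j)) n
    (fun Q r => v r Q) q

/-- The embedding inequality when all the variables of `u` are paired with Haar functions. The
variables are removed one at a time: the averages of `v` in one of them are dominated by its maximal
function, up to the last variable, where the Carleson embedding theorem applies. -/
theorem sum_gridCoeff_sq_mul_le_of_nonneg (n k : ℕ) {u : (Fin (k + 1) → Cell n) → ℂ} {B : ℝ}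
    (hB : 0 ≤ B) (hu : OscLe n B u) {v : (Fin (k + 1) → Cell n) → ℝ} (hv : ∀ Q, 0 ≤ v Q) :
    ∑ R : Fin (k + 1) → Node n, ‖gridCoeff n (fun _ => 0) (nodeRect R) u‖ ^ 2 *
        gridCoeff n (fun _ => 1) (nodeRect R) v ^ 2 ≤
      13 * B ^ 2 * 4 ^ (k + 1) * ((((2 : ℝ) ^ n)⁻¹) ^ (k + 1) * ∑ Q, v Q ^ 2) := by
  induction k with
  | zero =>
    obtain ⟨e⟩ : Nonempty (Fin 0 → Cell n) := ⟨Fin.elim0⟩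
    have hosc : ∀ I : DyadicInterval, I.gen ≤ n → cellCoeff n 1 I (fun q =>
        ‖u (Fin.insertNth (α := fun _ => Cell n) 0 q e) -
          cellCoeff n 1 I fun r => u (Fin.insertNth (α := fun _ => Cell n) 0 r e)‖) ≤ B := by
      intro I hI
      have h := hu (fun _ => I) fun _ => hI
      rw [gridCoeff_succ n 0, gridCoeff_succ n 0] at h
      simpa only [gridCoeff_fin_zero _ _ _ e] using h
    have h := sum_cellCoeff_sq_mul_le_of_osc hB hosc
      (v := fun q => v (Fin.insertNth (α := fun _ => Cell n) 0 q e)) fun q => hv _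
    rw [sum_insertNth 0, sum_insertNth 0 (fun Q => v Q ^ 2)]
    simpa only [gridCoeff_insertNth, gridCoeff_fin_zero _ _ _ e, Fintype.sum_subsingleton _ e,
      Fintype.sum_subsingleton _ (Fin.elim0 : Fin 0 → Node n), zero_add, pow_one] using h
  | succ k ih =>
    have hw : (0 : ℝ) ≤ ((2 : ℝ) ^ n)⁻¹ := by positivity
    -- The maximal function of `v` in the variable that is removed.
    set M : Cell n → (Fin (k + 1) → Cell n) → ℝ := fun q Q' =>
      cellMax n (fun r => v (Fin.insertNth (α := fun _ => Cell n) 0 r Q')) q with hM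
    have hM0 : ∀ q Q', 0 ≤ M q Q' := fun q Q' =>
      (hv _).trans (le_cellMax n (fun r => v (Fin.insertNth (α := fun _ => Cell n) 0 r Q')) q)
    have h1 : ∀ R' : Fin (k + 1) → Node n,
        ∑ x : Node n,
          ‖gridCoeff n (fun _ => 0) (nodeRect (Fin.insertNth (α := fun _ => Node n) 0 x R')) u‖ ^ 2 *
          gridCoeff n (fun _ => 1) (nodeRect (Fin.insertNth (α := fun _ => Node n) 0 x R')) v ^ 2 ≤
        ((2 : ℝ) ^ n)⁻¹ * ∑ q, ‖gridCoeff n (fun _ => 0) (nodeRect R') fun Q' =>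
            u (Fin.insertNth (α := fun _ => Cell n) 0 q Q')‖ ^ 2 *
          gridCoeff n (fun _ => 1) (nodeRect R') (M q) ^ 2 := by
      intro R'
      simp only [gridCoeff_insertNth]
      have hV : ∀ q : Cell n, 0 ≤ gridCoeff n (fun _ => 1) (nodeRect R') fun Q' =>
          v (Fin.insertNth (α := fun _ => Cell n) 0 q Q') := fun q =>
        gridCoeff_nonneg fun Q' => hv _
      refine (sum_cellCoeff_sq_mul_le n _ hV).trans ?_
      gcongr with q
      · exact (hV q).trans (le_cellMax n (fun q => gridCoeff n (fun _ => 1) (nodeRect R') fun Q' =>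
          v (Fin.insertNth (α := fun _ => Cell n) 0 q Q')) q)
      · exact cellMax_gridCoeff_le (nodeRect R')
          (fun r Q' => v (Fin.insertNth (α := fun _ => Cell n) 0 r Q')) q
    have h2 : ∀ q : Cell n, ∑ R' : Fin (k + 1) → Node n,
        ‖gridCoeff n (fun _ => 0) (nodeRect R') fun Q' =>
          u (Fin.insertNth (α := fun _ => Cell n) 0 q Q')‖ ^ 2 *
          gridCoeff n (fun _ => 1) (nodeRect R') (M q) ^ 2 ≤
        13 * B ^ 2 * 4 ^ (k + 1) * ((((2 : ℝ) ^ n)⁻¹) ^ (k + 1) * ∑ Q', M q Q' ^ 2) := fun q =>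
      ih (hu.slice 0 q) (hM0 q)
    have h3 : ∑ q, ∑ Q', M q Q' ^ 2 ≤ 4 * ∑ Q, v Q ^ 2 := by
      rw [sum_insertNth 0 (fun Q => v Q ^ 2), Finset.sum_comm]
      refine (Finset.sum_le_sum fun Q' _ => sum_cellMax_sq_le n _).trans_eq ?_
      rw [← Finset.mul_sum, Finset.sum_comm]
    rw [sum_insertNth 0, Finset.sum_comm]
    calc _ ≤ ∑ R' : Fin (k + 1) → Node n, ((2 : ℝ) ^ n)⁻¹ * ∑ q,
            ‖gridCoeff n (fun _ => 0) (nodeRect R') fun Q' =>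
              u (Fin.insertNth (α := fun _ => Cell n) 0 q Q')‖ ^ 2 *
            gridCoeff n (fun _ => 1) (nodeRect R') (M q) ^ 2 :=
          Finset.sum_le_sum fun R' _ => h1 R'
      _ = ((2 : ℝ) ^ n)⁻¹ * ∑ q, ∑ R' : Fin (k + 1) → Node n,
            ‖gridCoeff n (fun _ => 0) (nodeRect R') fun Q' =>
              u (Fin.insertNth (α := fun _ => Cell n) 0 q Q')‖ ^ 2 *
            gridCoeff n (fun _ => 1) (nodeRect R') (M q) ^ 2 := by
          rw [← Finset.mul_sum, Finset.sum_comm]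
      _ ≤ ((2 : ℝ) ^ n)⁻¹ * ∑ q,
            13 * B ^ 2 * 4 ^ (k + 1) * ((((2 : ℝ) ^ n)⁻¹) ^ (k + 1) * ∑ Q', M q Q' ^ 2) := by
          gcongr with q
          exact h2 q
      _ = 13 * B ^ 2 * 4 ^ (k + 1) * (((2 : ℝ) ^ n)⁻¹) ^ (k + 2) * ∑ q, ∑ Q', M q Q' ^ 2 := by
          simp only [← Finset.mul_sum]; ring
      _ ≤ 13 * B ^ 2 * 4 ^ (k + 1) * (((2 : ℝ) ^ n)⁻¹) ^ (k + 2) * (4 * ∑ Q, v Q ^ 2) := by gcongr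
      _ = _ := by ring

/-- The embedding inequality on the grid. A variable in which `u` is averaged is removed by Bessel's
inequality for `g`, since averages of `u` inherit the bound on the mean oscillations. -/
theorem sum_gridCoeff_sq_mul_le (n : ℕ) {β : Fin N → Fin 2} (hβ : ∃ j, β j = 1)
    {u : (Fin N → Cell n) → ℂ} {B : ℝ} (hB : 0 ≤ B) (hu : OscLe n B u)
    (g : (Fin N → Cell n) → ℂ) :
    ∑ R : Fin N → Node n, ‖gridCoeff n (fun j => if β j = 0 then 1 else 0) (nodeRect R) u‖ ^ 2 *
        ‖gridCoeff n β (nodeRect R) g‖ ^ 2 ≤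
      13 * B ^ 2 * 4 ^ N * ((((2 : ℝ) ^ n)⁻¹) ^ N * ∑ Q, ‖g Q‖ ^ 2) := by
  induction N with
  | zero => exact hβ.choose.elim0
  | succ N ih =>
    by_cases h : ∃ p, β p = 0
    · obtain ⟨p, hp⟩ := h
      obtain ⟨j, hj⟩ := hβ
      obtain ⟨j', rfl⟩ : ∃ j', p.succAbove j' = j :=
        Fin.exists_succAbove_eq fun hjp => by rw [hjp, hp] at hj; exact absurd hj (by decide)
      have h1 : ∀ x : Node n, ∑ R' : Fin N → Node n,
          ‖gridCoeff n (fun j => if β (p.succAbove j) = 0 then 1 else 0) (nodeRect R') fun Q' =>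
              cellCoeff n 1 x.toInterval fun q => u (p.insertNth q Q')‖ ^ 2 *
            ‖gridCoeff n (fun j => β (p.succAbove j)) (nodeRect R') fun Q' =>
              cellCoeff n 0 x.toInterval fun q => g (p.insertNth q Q')‖ ^ 2 ≤
          13 * B ^ 2 * 4 ^ N * ((((2 : ℝ) ^ n)⁻¹) ^ N * ∑ Q' : Fin N → Cell n,
            ‖cellCoeff n 0 x.toInterval fun q => g (p.insertNth q Q')‖ ^ 2) := fun x =>
        ih ⟨j', hj⟩ (hu.average p x.gen_lt.le) _
      have h2 : ∑ x : Node n, ∑ Q' : Fin N → Cell n,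
          ‖cellCoeff n 0 x.toInterval fun q => g (p.insertNth q Q')‖ ^ 2 ≤
          ((2 : ℝ) ^ n)⁻¹ * ∑ Q, ‖g Q‖ ^ 2 := by
        rw [sum_insertNth p (fun Q => ‖g Q‖ ^ 2), Finset.sum_comm]
        refine (Finset.sum_le_sum fun Q' _ => sum_norm_sq_cellCoeff_le n _).trans_eq ?_
        rw [← Finset.mul_sum, Finset.sum_comm]
      rw [sum_insertNth p]
      simp only [gridCoeff_insertNth', hp, if_true]
      refine (Finset.sum_le_sum fun x _ => h1 x).trans ?_
      rw [← Finset.mul_sum, ← Finset.mul_sum]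
      calc _ ≤ 13 * B ^ 2 * 4 ^ N * ((((2 : ℝ) ^ n)⁻¹) ^ N *
              (((2 : ℝ) ^ n)⁻¹ * ∑ Q, ‖g Q‖ ^ 2)) := by gcongr
        _ = 13 * B ^ 2 * 4 ^ N * ((((2 : ℝ) ^ n)⁻¹) ^ (N + 1) * ∑ Q, ‖g Q‖ ^ 2) := by ring
        _ ≤ _ := by
          gcongr
          · norm_num
          · omega
    · have hone : β = fun _ => 1 := by
        funext j
        have := not_exists.1 h j
        omega
      subst hone
      refine le_trans (Finset.sum_le_sum fun R _ => ?_)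
        (sum_gridCoeff_sq_mul_le_of_nonneg n N hB hu (v := fun Q => ‖g Q‖) fun Q => norm_nonneg _)
      simp only [Fin.isValue, one_ne_zero, if_false]
      gcongr
      exact norm_gridCoeff_le g

end Multi

end DyadicGrid

/-! ### Haar coefficients on the torus and the paraproduct -/

namespace DyadicRect

open DyadicInterval DyadicGrid

variable {N : ℕ}

/-- The real valued function `h_R^ε`. -/
noncomputable def haarReal (ε : Fin N → Fin 2) (R : DyadicRect N) (t : Torus N) : ℝ :=
  ∏ j, (R j).haarE (ε j) (t j)

theorem haarFun_eq (ε : Fin N → Fin 2) (R : DyadicRect N) (t : Torus N) :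
    haarFun ε R t = (haarReal ε R t : ℂ) := by
  simp [haarFun, haarReal]

theorem measurable_haarReal (ε : Fin N → Fin 2) (R : DyadicRect N) : Measurable (haarReal ε R) :=
  Finset.measurable_prod _ fun j _ => (measurable_haarE (ε j) (R j)).comp (measurable_pi_apply j)

theorem exists_abs_haarReal_le (ε : Fin N → Fin 2) (R : DyadicRect N) :
    ∃ M : ℝ, ∀ t, ‖haarReal ε R t‖ ≤ M := by
  choose M hM0 hM using fun j => DyadicInterval.exists_abs_haarE_le (ε j) (R j)
  refine ⟨∏ j, M j, fun t => ?_⟩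
  rw [haarReal, norm_prod]
  exact Finset.prod_le_prod (fun j _ => norm_nonneg _) fun j _ => hM j (t j)

theorem haarReal_one_nonneg (R : DyadicRect N) (t : Torus N) : 0 ≤ haarReal (fun _ => 1) R t :=
  Finset.prod_nonneg fun j _ => haarE_one_nonneg (R j) (t j)

theorem integral_haarReal_mul (ε ε' : Fin N → Fin 2) (R R' : DyadicRect N) :
    ∫ t, haarReal ε R t * haarReal ε' R' t = ∏ j, pairing (ε j) (R j) (ε' j) (R' j) := by
  simp only [haarReal, ← Finset.prod_mul_distrib, pairing]
  exact integral_fintype_prod_volume_eq_prod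
    (f := fun j x => (R j).haarE (ε j) x * (R' j).haarE (ε' j) x)

theorem integral_haarReal_one (R : DyadicRect N) : ∫ t, haarReal (fun _ => 1) R t = 1 := by
  simp only [haarReal]
  rw [integral_fintype_prod_volume_eq_prod (f := fun j x => (R j).haarE 1 x)]
  simp [integral_haarE_one]

theorem measurableSet_toSet (R : DyadicRect N) : MeasurableSet R.toSet :=
  MeasurableSet.univ_pi fun j => (R j).measurableSet_toSet

theorem volume_toSet (R : DyadicRect N) :
    volume R.toSet = ENNReal.ofReal (∏ j, (R j).length) := by
  rw [toSet, volume_pi_pi, ENNReal.ofReal_prod_of_nonneg fun j _ => (R j).length_pos.le]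
  simp only [DyadicInterval.volume_toSet]

theorem prod_length_pos (R : DyadicRect N) : 0 < ∏ j, (R j).length :=
  Finset.prod_pos fun j _ => (R j).length_pos

theorem haarReal_one (R : DyadicRect N) (t : Torus N) :
    haarReal (fun _ => 1) R t = R.toSet.indicator (fun _ => (∏ j, (R j).length)⁻¹) t := by
  by_cases h : t ∈ R.toSet
  · rw [Set.indicator_of_mem h, haarReal, ← Finset.prod_inv_distrib]
    exact Finset.prod_congr rfl fun j _ => by
      rw [haarE_one, Set.indicator_of_mem (h j (Set.mem_univ j))]
  · rw [Set.indicator_of_notMem h]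
    simp only [toSet, Set.mem_pi, Set.mem_univ, true_implies, not_forall] at h
    obtain ⟨j, hj⟩ := h
    exact Finset.prod_eq_zero (Finset.mem_univ j) (haarE_eq_zero hj)

/-- A cell of the grid of generation `n` on the torus, as a dyadic rectangle. -/
def cellRect (n : ℕ) (Q : Fin N → Cell n) : DyadicRect N := fun j => ⟨n, Q j⟩

theorem haarReal_eq_gridCoeff {n : ℕ} {ε : Fin N → Fin 2} {R : DyadicRect N}
    (h : ∀ j, (R j).gen + (1 - ε j : ℕ) ≤ n) (t : Torus N) :
    haarReal ε R t = gridCoeff n ε R fun Q => haarReal (fun _ => 1) (cellRect n Q) t := by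
  rw [haarReal, Finset.prod_congr rfl fun j _ => haarE_eq_sum (ε j) (h j) (t j),
    Finset.prod_univ_sum, Fintype.piFinset_univ]
  refine Finset.sum_congr rfl fun Q _ => ?_
  rw [Finset.prod_mul_distrib]
  rfl

theorem integrable_haarReal_smul {E : Type*} [NormedAddCommGroup E] [NormedSpace ℝ E]
    (ε : Fin N → Fin 2) (R : DyadicRect N)
    {f : Torus N → E} (hf : Integrable f) : Integrable fun t => haarReal ε R t • f t := by
  obtain ⟨M, hM⟩ := exists_abs_haarReal_le ε R
  exact hf.bdd_smul M (measurable_haarReal ε R).aestronglyMeasurable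
    (Filter.Eventually.of_forall hM)

/-- Pairings with `h_R^ε` depend only on the averages over the cells of a fine grid. -/
theorem integral_haarReal_smul_eq {E : Type*} [NormedAddCommGroup E] [NormedSpace ℝ E]
    {n : ℕ} {ε : Fin N → Fin 2} {R : DyadicRect N}
    (h : ∀ j, (R j).gen + (1 - ε j : ℕ) ≤ n) {f : Torus N → E} (hf : Integrable f) :
    ∫ t, haarReal ε R t • f t =
      gridCoeff n ε R fun Q => ∫ t, haarReal (fun _ => 1) (cellRect n Q) t • f t := by
  simp only [haarReal_eq_gridCoeff h, gridCoeff, Finset.sum_smul, smul_eq_mul, mul_smul]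
  refine (integral_finsetSum _ fun Q _ => (integrable_haarReal_smul _ (cellRect n Q) hf).smul
    (∏ j, kernel n (ε j) (R j) (Q j))).trans ?_
  exact Finset.sum_congr rfl fun Q _ => integral_smul _ _

theorem integrable_coe (f : L2Torus N) : Integrable f :=
  (Lp.memLp f).integrable (by norm_num)

theorem coeff_eq_integral (ε : Fin N → Fin 2) (f : L2Torus N) (R : DyadicRect N) :
    coeff ε f R = ∫ t, haarReal ε R t • f t := by
  rw [coeff, L2.inner_def]
  refine integral_congr_ae ?_
  filter_upwards [(memLp_haarFun ε R).coeFn_toLp] with t ht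
  rw [haarLp, ht, haarFun_eq, RCLike.inner_apply, Complex.conj_ofReal, Complex.real_smul, mul_comm]

theorem coeff_eq_gridCoeff {n : ℕ} {ε : Fin N → Fin 2} {R : DyadicRect N}
    (h : ∀ j, (R j).gen + (1 - ε j : ℕ) ≤ n) (f : L2Torus N) :
    coeff ε f R = gridCoeff n ε R fun Q => coeff (fun _ => 1) f (cellRect n Q) := by
  simp only [coeff_eq_integral]
  exact integral_haarReal_smul_eq h (integrable_coe f)

theorem inner_haarLp (ε ε' : Fin N → Fin 2) (R R' : DyadicRect N) :
    inner ℂ (haarLp ε R) (haarLp ε' R') =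
      ((∏ j, pairing (ε j) (R j) (ε' j) (R' j) : ℝ) : ℂ) := by
  have h : inner ℂ (haarLp ε R) (haarLp ε' R') = coeff ε (haarLp ε' R') R := rfl
  rw [h, coeff_eq_integral, ← integral_haarReal_mul, ← integral_complex_ofReal]
  refine integral_congr_ae ?_
  filter_upwards [(memLp_haarFun ε' R').coeFn_toLp] with t ht
  rw [haarLp, ht, haarFun_eq, Complex.real_smul]
  push_cast
  rfl

theorem orthonormal_haarLp : Orthonormal ℂ (haarLp (N := N) 0) := by
  classical
  rw [orthonormal_iff_ite]
  intro R R'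
  rw [inner_haarLp]
  split_ifs with h
  · subst h
    simp [pairing_zero_zero_self]
  · obtain ⟨j, hj⟩ := Function.ne_iff.1 h
    rw [Finset.prod_eq_zero (Finset.mem_univ j) (pairing_zero_zero_of_ne hj), Complex.ofReal_zero]

theorem toSet_subset_of_inner_ne_zero {β : Fin N → Fin 2} {R Q : DyadicRect N}
    (h : inner ℂ (haarLp 0 Q) (haarLp β R) ≠ 0) : R.toSet ⊆ Q.toSet := by
  rw [inner_haarLp, Complex.ofReal_ne_zero, Finset.prod_ne_zero_iff] at h
  exact Set.pi_mono fun j _ =>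
    subset_of_pairing_zero_ne (by rw [pairing_comm]; exact h j (Finset.mem_univ j))

/-- The averages of `g` over the cells of a grid are controlled by its norm. -/
theorem sum_norm_sq_coeff_cellRect_le (n : ℕ) (g : L2Torus N) :
    (((2 : ℝ) ^ n)⁻¹) ^ N * ∑ Q : Fin N → Cell n, ‖coeff (fun _ => 1) g (cellRect n Q)‖ ^ 2 ≤
      ‖g‖ ^ 2 := by
  classical
  set w : ℝ := (((2 : ℝ) ^ n)⁻¹) ^ N with hw
  have hw0 : 0 < w := by positivity
  have ho : Orthonormal ℂ fun Q : Fin N → Cell n =>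
      ((Real.sqrt w : ℝ) : ℂ) • haarLp (fun _ => 1) (cellRect n Q) := by
    rw [orthonormal_iff_ite]
    intro Q Q'
    rw [inner_smul_left, inner_smul_right, inner_haarLp, Complex.conj_ofReal, ← mul_assoc,
      ← Complex.ofReal_mul, Real.mul_self_sqrt hw0.le]
    split_ifs with h
    · subst h
      simp only [pairing_one_one_self, cellRect, DyadicInterval.length, inv_inv,
        Finset.prod_const, Finset.card_univ, Fintype.card_fin]
      rw [← Complex.ofReal_mul, hw, ← mul_pow, inv_mul_cancel₀ (by positivity), one_pow,
        Complex.ofReal_one]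
    · obtain ⟨j, hj⟩ := Function.ne_iff.1 h
      rw [Finset.prod_eq_zero (Finset.mem_univ j), Complex.ofReal_zero, mul_zero]
      refine pairing_eq_zero_of_gen_eq rfl fun hc => hj ?_
      simpa [cellRect] using hc
  refine le_trans (le_of_eq ?_) (ho.sum_inner_products_le g (s := Finset.univ))
  rw [Finset.mul_sum]
  refine Finset.sum_congr rfl fun Q _ => ?_
  rw [inner_smul_left, norm_mul, mul_pow, Complex.conj_ofReal, Complex.norm_real,
    Real.norm_of_nonneg (Real.sqrt_nonneg w), Real.sq_sqrt hw0.le]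
  rfl

theorem coeff_one_eq_average (f : L2Torus N) (R : DyadicRect N) :
    coeff (fun _ => 1) f R = ⨍ s in R.toSet, f s := by
  have h : ∀ t, haarReal (fun _ => 1) R t • f t =
      R.toSet.indicator (fun t => (∏ j, (R j).length)⁻¹ • f t) t := fun t => by
    rw [haarReal_one]
    by_cases ht : t ∈ R.toSet <;> simp [ht]
  rw [coeff_eq_integral, setAverage_eq, measureReal_def, volume_toSet,
    ENNReal.toReal_ofReal R.prod_length_pos.le]
  simp only [h]
  rw [integral_indicator R.measurableSet_toSet, integral_smul]

theorem integral_haarReal_one_mul_norm_le {f : L2Torus N} (hf : f ∈ bmod N) (R : DyadicRect N) :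
    ∫ t, haarReal (fun _ => 1) R t * ‖f t - coeff (fun _ => 1) f R‖ ≤ (bmodNorm f).toReal := by
  have h : ∀ t, haarReal (fun _ => 1) R t * ‖f t - coeff (fun _ => 1) f R‖ =
      R.toSet.indicator
        (fun t => (∏ j, (R j).length)⁻¹ * ‖f t - coeff (fun _ => 1) f R‖) t := fun t => by
    rw [haarReal_one]
    by_cases ht : t ∈ R.toSet <;> simp [ht]
  have hi : Integrable (fun t => f t - coeff (fun _ => 1) f R) :=
    (integrable_coe f).sub (integrable_const _)
  simp only [h]
  rw [integral_indicator R.measurableSet_toSet, integral_const_mul,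
    ← ENNReal.ofReal_le_iff_le_toReal hf.ne,
    ENNReal.ofReal_mul (inv_nonneg.2 R.prod_length_pos.le),
    ofReal_integral_norm_eq_lintegral_enorm hi.integrableOn,
    ENNReal.ofReal_inv_of_pos R.prod_length_pos, ← volume_toSet, coeff_one_eq_average]
  exact le_iSup (fun R : DyadicRect N =>
    (volume R.toSet)⁻¹ * ∫⁻ t in R.toSet, ‖f t - ⨍ s in R.toSet, f s‖ₑ) R

theorem norm_coeff_one_sub_le (f : L2Torus N) (R : DyadicRect N) (c : ℂ) :
    ‖coeff (fun _ => 1) f R - c‖ ≤ ∫ t, haarReal (fun _ => 1) R t * ‖f t - c‖ := by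
  have h : coeff (fun _ => 1) f R - c = ∫ t, haarReal (fun _ => 1) R t • (f t - c) := by
    simp only [smul_sub]
    rw [integral_sub (integrable_haarReal_smul _ _ (integrable_coe f))
      (integrable_haarReal_smul _ _ (integrable_const _)), integral_smul_const,
      integral_haarReal_one, one_smul, coeff_eq_integral]
  rw [h]
  refine (norm_integral_le_integral_norm _).trans_eq ?_
  simp only [norm_smul, Real.norm_of_nonneg (haarReal_one_nonneg R _)]

/-- Passing to the averages over the cells of a grid does not increase the mean oscillations. -/
theorem oscLe_of_mem_bmod {f : L2Torus N} (hf : f ∈ bmod N) (n : ℕ) :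
    OscLe n (bmodNorm f).toReal fun Q : Fin N → Cell n =>
      coeff (fun _ => 1) f (cellRect n Q) := by
  intro R hR
  have hR' : ∀ j, (R j).gen + (1 - (1 : Fin 2) : ℕ) ≤ n := fun j => by simpa using hR j
  rw [← coeff_eq_gridCoeff (ε := fun _ => 1) hR' f]
  have hi : Integrable (fun t => ‖f t - coeff (fun _ => 1) f R‖) :=
    ((integrable_coe f).sub (integrable_const _)).norm
  have h := integral_haarReal_smul_eq (ε := fun _ => 1) hR' hi
  refine (gridCoeff_mono fun Q => norm_coeff_one_sub_le f (cellRect n Q) _).trans ?_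
  refine le_trans (le_of_eq ?_) (integral_haarReal_one_mul_norm_le hf R)
  simpa only [smul_eq_mul] using h.symm

/-- The embedding inequality: for `f` in `bmo^d` and `β ≠ 0`, the squares `|⟨f, h_R^δ⟩|²` are the
weights of a bounded embedding `g ↦ (⟨g, h_R^β⟩)_R` of `L²`. -/
theorem sum_coeff_sq_mul_le {β : Fin N → Fin 2} (hβ : ∃ j, β j = 1) {f : L2Torus N}
    (hf : f ∈ bmod N) (g : L2Torus N) (A : Finset (DyadicRect N)) :
    ∑ R ∈ A, ‖coeff (fun j => if β j = 0 then 1 else 0) f R‖ ^ 2 * ‖coeff β g R‖ ^ 2 ≤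
      13 * (bmodNorm f).toReal ^ 2 * 4 ^ N * ‖g‖ ^ 2 := by
  classical
  obtain ⟨n, hn⟩ : ∃ n, ∀ R ∈ A, ∀ j, (R j).gen < n := by
    refine ⟨A.sup (fun R => Finset.univ.sup fun j => (R j).gen) + 1, fun R hR j => ?_⟩
    have h1 : (R j).gen ≤ Finset.univ.sup fun j => (R j).gen :=
      Finset.le_sup (f := fun j => (R j).gen) (Finset.mem_univ j)
    have h2 := Finset.le_sup (f := fun R : DyadicRect N => Finset.univ.sup fun j => (R j).gen) hR
    exact Nat.lt_succ_of_le (h1.trans h2)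
  have hsub : A ⊆ Finset.univ.image (nodeRect : (Fin N → Node n) → DyadicRect N) := by
    intro R hR
    rw [Finset.mem_image]
    exact ⟨fun j => ⟨⟨(R j).gen, hn R hR j⟩, (R j).pos⟩, Finset.mem_univ _, rfl⟩
  have hinj : Function.Injective (nodeRect : (Fin N → Node n) → DyadicRect N) := by
    exact fun R R' h => funext fun j => Node.toInterval_injective (congrFun h j)
  have hgen : ∀ (ε : Fin N → Fin 2) (R : Fin N → Node n) (j : Fin N),
      (nodeRect R j).gen + (1 - ε j : ℕ) ≤ n := fun ε R j => by
    have := (R j).gen_lt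
    simp only [nodeRect]
    omega
  refine (Finset.sum_le_sum_of_subset_of_nonneg hsub fun R _ _ => by positivity).trans ?_
  rw [Finset.sum_image hinj.injOn]
  simp only [fun R => coeff_eq_gridCoeff (hgen β R) g, fun R => coeff_eq_gridCoeff
    (hgen (fun j => if β j = 0 then 1 else 0) R) f]
  refine (sum_gridCoeff_sq_mul_le n hβ ENNReal.toReal_nonneg (oscLe_of_mem_bmod hf n) _).trans ?_
  gcongr
  exact sum_norm_sq_coeff_cellRect_le n g

/-- The dual form of the embedding inequality. -/
theorem norm_sq_sum_paraproductTerm_le {β : Fin N → Fin 2} (hβ : ∃ j, β j = 1) {f : L2Torus N}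
    (hf : f ∈ bmod N) (φ : L2Torus N) (A : Finset (DyadicRect N)) :
    ‖∑ R ∈ A, paraproductTerm β φ f R‖ ^ 2 ≤
      13 * (bmodNorm f).toReal ^ 2 * 4 ^ N * ∑ R ∈ A, ‖coeff 0 φ R‖ ^ 2 := by
  set G := ∑ R ∈ A, paraproductTerm β φ f R with hG
  set K := 13 * (bmodNorm f).toReal ^ 2 * 4 ^ N with hK
  have h1 : ‖G‖ ^ 2 ≤ ∑ R ∈ A, ‖coeff 0 φ R‖ *
      (‖coeff (fun j => if β j = 0 then 1 else 0) f R‖ * ‖coeff β G R‖) := by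
    have h : ((‖G‖ ^ 2 : ℝ) : ℂ) = ∑ R ∈ A, inner ℂ G (paraproductTerm β φ f R) := by
      rw [← inner_sum, ← hG, inner_self_eq_norm_sq_to_K]
      push_cast
      rfl
    have h' : ‖G‖ ^ 2 = ‖((‖G‖ ^ 2 : ℝ) : ℂ)‖ := by
      rw [Complex.norm_real, Real.norm_of_nonneg (by positivity)]
    rw [h', h]
    refine (norm_sum_le _ _).trans_eq (Finset.sum_congr rfl fun R _ => ?_)
    rw [paraproductTerm, BTerm, inner_smul_right, norm_mul, norm_mul, ← mul_assoc,
      norm_inner_symm]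
    rfl
  have h2 := Finset.sum_mul_sq_le_sq_mul_sq A (fun R => ‖coeff 0 φ R‖)
    fun R => ‖coeff (fun j => if β j = 0 then 1 else 0) f R‖ * ‖coeff β G R‖
  have h3 := sum_coeff_sq_mul_le hβ hf G A
  simp only [mul_pow] at h2
  have h4 : (‖G‖ ^ 2) ^ 2 ≤ (∑ R ∈ A, ‖coeff 0 φ R‖ ^ 2) * (K * ‖G‖ ^ 2) := by
    refine (pow_le_pow_left₀ (by positivity) h1 2).trans (h2.trans ?_)
    gcongr
  rcases eq_or_ne (‖G‖ ^ 2) 0 with h0 | h0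
  · rw [h0]; positivity
  · have h5 : 0 < ‖G‖ ^ 2 := lt_of_le_of_ne (by positivity) h0.symm
    refine le_of_mul_le_mul_right ?_ h5
    linarith

theorem summable_norm_sq_coeff (φ : L2Torus N) :
    Summable fun R : DyadicRect N => ‖coeff 0 φ R‖ ^ 2 :=
  orthonormal_haarLp.inner_products_summable (x := φ)

theorem summable_paraproductTerm {β : Fin N → Fin 2} (hβ : ∃ j, β j = 1) {f : L2Torus N}
    (hf : f ∈ bmod N) (φ : L2Torus N) : Summable (paraproductTerm β φ f) := by
  set K := 13 * (bmodNorm f).toReal ^ 2 * 4 ^ N with hK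
  have hK0 : 0 ≤ K := by positivity
  rw [summable_iff_vanishing_norm]
  intro e he
  have he' : 0 < e ^ 2 / (K + 1) := by positivity
  obtain ⟨s, hs⟩ := summable_iff_vanishing_norm.1 (summable_norm_sq_coeff φ) _ he'
  refine ⟨s, fun A hA => ?_⟩
  have h1 := norm_sq_sum_paraproductTerm_le hβ hf φ A
  have h2 := (le_abs_self _).trans_lt (hs A hA)
  rw [lt_div_iff₀ (by positivity)] at h2
  have h3 : 0 ≤ ∑ R ∈ A, ‖coeff 0 φ R‖ ^ 2 := by positivity
  refine lt_of_pow_lt_pow_left₀ 2 he.le (lt_of_le_of_lt h1 ?_)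
  linarith

theorem tsum_enorm_sq_coeff_le (g : L2Torus N) :
    ∑' Q : DyadicRect N, ‖coeff 0 g Q‖ₑ ^ 2 ≤ ‖g‖ₑ ^ 2 := by
  have h := orthonormal_haarLp.tsum_inner_products_le (x := g)
  have e : ∀ z : ℂ, ‖z‖ₑ ^ 2 = ENNReal.ofReal (‖z‖ ^ 2) := fun z => by
    rw [ENNReal.ofReal_pow (norm_nonneg _), ofReal_norm]
  simp only [e]
  rw [← ENNReal.ofReal_tsum_of_nonneg (fun Q => by positivity) (summable_norm_sq_coeff g),
    ← ofReal_norm g, ← ENNReal.ofReal_pow (norm_nonneg _)]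
  exact ENNReal.ofReal_le_ofReal h

theorem coeff_starProjection (g : L2Torus N) (Q : DyadicRect N) :
    coeff 0 ((L20 N).starProjection g) Q = coeff 0 g Q := by
  have hQ : haarLp 0 Q ∈ L20 N :=
    Submodule.le_topologicalClosure _ (Submodule.subset_span ⟨Q, rfl⟩)
  rw [coeff, coeff, ← Submodule.inner_starProjection_left_eq_right,
    Submodule.starProjection_eq_self_iff.2 hQ]

/-- The energy of the paraproduct in `Ω` is controlled by the energy of `φ` in `Ω`: the coefficient
of `Π_φ^β f` at `Q` involves only the rectangles `R ⊆ Q`. -/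
theorem haarEnergy_paraproduct_le {β : Fin N → Fin 2} (hβ : ∃ j, β j = 1) {f : L2Torus N}
    (hf : f ∈ bmod N) (φ : L2Torus N) (Ω : Set (Torus N)) :
    haarEnergy ((L20 N).starProjection (paraproduct β φ f)) Ω ≤
      ENNReal.ofReal (13 * (bmodNorm f).toReal ^ 2 * 4 ^ N) * haarEnergy φ Ω := by
  classical
  set K := 13 * (bmodNorm f).toReal ^ 2 * 4 ^ N with hK
  have hs := summable_paraproductTerm hβ hf φ
  set S : Set (DyadicRect N) := {R | R.InsideAE Ω} with hS
  -- The part of the paraproduct that lives in `Ω`.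
  set G : L2Torus N := ∑' R, S.indicator (paraproductTerm β φ f) R with hG
  have hGs : HasSum (S.indicator (paraproductTerm β φ f)) G := (hs.indicator S).hasSum
  have hcoeff : ∀ Q ∈ S, coeff 0 (paraproduct β φ f) Q = coeff 0 G Q := by
    intro Q hQ
    have h1 : coeff 0 (paraproduct β φ f) Q =
        ∑' R, innerSL ℂ (haarLp 0 Q) (paraproductTerm β φ f R) :=
      (innerSL ℂ (haarLp 0 Q)).map_tsum hs
    have h2 : coeff 0 G Q =
        ∑' R, innerSL ℂ (haarLp 0 Q) (S.indicator (paraproductTerm β φ f) R) :=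
      (innerSL ℂ (haarLp 0 Q)).map_tsum (hs.indicator S)
    rw [h1, h2]
    refine tsum_congr fun R => ?_
    by_cases hR : R ∈ S
    · rw [Set.indicator_of_mem hR]
    · rw [Set.indicator_of_notMem hR, map_zero, innerSL_apply_apply, paraproductTerm, BTerm,
        inner_smul_right]
      by_contra hne
      refine hR (measure_mono_null (Set.sdiff_subset_sdiff_left
        (toSet_subset_of_inner_ne_zero (right_ne_zero_of_mul hne))) hQ)
  have hGle : ‖G‖ₑ ^ 2 ≤ ENNReal.ofReal K * haarEnergy φ Ω := by
    have hc : Continuous fun x : L2Torus N => ‖x‖ₑ ^ 2 := (ENNReal.continuous_pow 2).comp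
      continuous_enorm
    refine le_of_tendsto ((hc.tendsto G).comp hGs) (Filter.Eventually.of_forall fun A => ?_)
    have h1 : ∑ R ∈ A, S.indicator (paraproductTerm β φ f) R =
        ∑ R ∈ A.filter (· ∈ S), paraproductTerm β φ f R := by
      rw [Finset.sum_filter]
      exact Finset.sum_congr rfl fun R _ => by simp [Set.indicator_apply]
    have h2 := norm_sq_sum_paraproductTerm_le hβ hf φ (A.filter (· ∈ S))
    have e : ∀ z : ℂ, ENNReal.ofReal (‖z‖ ^ 2) = ‖z‖ₑ ^ 2 := fun z => by
      rw [ENNReal.ofReal_pow (norm_nonneg _), ofReal_norm]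
    have h3 := ENNReal.ofReal_le_ofReal h2
    rw [ENNReal.ofReal_pow (norm_nonneg _), ofReal_norm, ENNReal.ofReal_mul (by positivity),
      ENNReal.ofReal_sum_of_nonneg fun R _ => by positivity] at h3
    simp only [e] at h3
    simp only [Function.comp_apply, h1]
    refine h3.trans ?_
    gcongr
    have h4 : ∑ R ∈ A.filter (· ∈ S), ‖coeff 0 φ R‖ₑ ^ 2 =
        ∑ R ∈ A.subtype (· ∈ S), ‖coeff 0 φ R.1‖ₑ ^ 2 :=
      (Finset.sum_subtype_eq_sum_filter _).symm
    rw [h4]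
    exact ENNReal.sum_le_tsum (f := fun R : S => ‖coeff 0 φ R.1‖ₑ ^ 2) _
  calc haarEnergy ((L20 N).starProjection (paraproduct β φ f)) Ω
      = ∑' Q : S, ‖coeff 0 G Q.1‖ₑ ^ 2 := tsum_congr fun Q => by
        rw [coeff_starProjection, hcoeff Q.1 Q.2]
    _ ≤ ∑' Q, ‖coeff 0 G Q‖ₑ ^ 2 :=
        ENNReal.tsum_comp_le_tsum_of_injective Subtype.val_injective
          (fun Q : DyadicRect N => ‖coeff 0 G Q‖ₑ ^ 2)
    _ ≤ ‖G‖ₑ ^ 2 := tsum_enorm_sq_coeff_le G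
    _ ≤ _ := hGle

theorem toSet_root : toSet (fun _ => root : DyadicRect N) = Set.univ := by
  refine Set.eq_univ_of_forall fun t j _ => ?_
  rw [mem_toSet_iff]
  have := dyadicPos_lt 0 (t j)
  simp only [root] at this ⊢
  omega

/-- The logarithmic mean oscillation norm dominates the product norm. -/
theorem inv_volume_mul_haarEnergy_le {β : Fin N → Fin 2} (hβ : ∃ j, β j = 1) (φ : L2Torus N)
    {Ω : Set (Torus N)} (hΩ : IsOpen Ω) :
    (volume Ω)⁻¹ * haarEnergy φ Ω ≤ LMOdNorm β φ ^ 2 := by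
  obtain ⟨j, -⟩ := hβ
  have hlog : 1 ≤ logWeight β (fun _ => root : DyadicRect N) := by
    have h4 : (1 : ℝ) ≤ Real.log 4 := by
      rw [Real.le_log_iff_exp_le (by norm_num)]
      linarith [Real.exp_one_lt_d9]
    have h : logWeight β (fun _ => root : DyadicRect N) = ∑ _j : Fin N, Real.log 4 := by
      simp [logWeight, root, DyadicInterval.length]
    rw [h]
    exact h4.trans (Finset.single_le_sum (f := fun _ : Fin N => Real.log 4)
      (fun _ _ => by linarith) (Finset.mem_univ j))
  have h1 : (1 : ℝ≥0∞) ≤ ENNReal.ofReal (logWeight β (fun _ => root : DyadicRect N)) ^ 2 :=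
    one_le_pow₀ (by rwa [ENNReal.one_le_ofReal])
  rw [LMOdNorm, ← ENNReal.rpow_natCast, ← ENNReal.rpow_mul]
  norm_num
  refine le_trans ?_ (le_iSup _ (fun _ => root : DyadicRect N))
  refine le_trans ?_ (le_iSup _ Ω)
  refine le_trans ?_ (le_iSup _ hΩ)
  refine le_trans ?_ (le_iSup _ (by rw [toSet_root]; exact Set.subset_univ Ω))
  rw [mul_assoc]
  exact le_mul_of_one_le_left zero_le h1

end DyadicRect

open DyadicRect in
theorem theorem4p2 (N : ℕ) :
    ∃ C : ℝ≥0, ∀ β : Fin N → Fin 2, β ≠ (fun _ => 0) → β ≠ (fun _ => 1) →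
      ∀ φ ∈ LMOd β, ∀ f ∈ bmod N,
        Summable (paraproductTerm β φ f) ∧
        (L20 N).starProjection (paraproduct β φ f) ∈ BMOd N ∧
        BMOdNorm ((L20 N).starProjection (paraproduct β φ f)) ≤
          C * LMOdNorm β φ * bmodNorm f := by
  refine ⟨NNReal.sqrt (13 * 4 ^ N), fun β hβ0 _ φ hφ f hf => ?_⟩
  have hβ : ∃ j, β j = 1 := by
    obtain ⟨j, hj⟩ := Function.ne_iff.1 hβ0
    exact ⟨j, by omega⟩
  have hK : ENNReal.ofReal (13 * (bmodNorm f).toReal ^ 2 * 4 ^ N) =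
      ((NNReal.sqrt (13 * 4 ^ N) : ℝ≥0) : ℝ≥0∞) ^ 2 * bmodNorm f ^ 2 := by
    rw [← ENNReal.coe_pow, NNReal.sq_sqrt, mul_right_comm, ENNReal.ofReal_mul (by positivity),
      ENNReal.ofReal_pow ENNReal.toReal_nonneg, ENNReal.ofReal_toReal hf.ne]
    congr 1
    rw [ENNReal.ofReal, Real.toNNReal_mul (by norm_num), Real.toNNReal_pow (by norm_num)]
    norm_num
  have hle : BMOdNorm ((L20 N).starProjection (paraproduct β φ f)) ≤
      (NNReal.sqrt (13 * 4 ^ N) : ℝ≥0) * LMOdNorm β φ * bmodNorm f := by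
    have h : (⨆ (Ω : Set (Torus N)) (_ : IsOpen Ω), (volume Ω)⁻¹ *
        haarEnergy ((L20 N).starProjection (paraproduct β φ f)) Ω) ≤
        ((NNReal.sqrt (13 * 4 ^ N) : ℝ≥0) * LMOdNorm β φ * bmodNorm f) ^ 2 := by
      refine iSup₂_le fun Ω hΩ => ?_
      calc _ ≤ (volume Ω)⁻¹ * (ENNReal.ofReal (13 * (bmodNorm f).toReal ^ 2 * 4 ^ N) *
              haarEnergy φ Ω) := by
            gcongr
            exact haarEnergy_paraproduct_le hβ hf φ Ω
        _ = ENNReal.ofReal (13 * (bmodNorm f).toReal ^ 2 * 4 ^ N) *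
              ((volume Ω)⁻¹ * haarEnergy φ Ω) := by ring
        _ ≤ ENNReal.ofReal (13 * (bmodNorm f).toReal ^ 2 * 4 ^ N) * LMOdNorm β φ ^ 2 := by
            gcongr
            exact inv_volume_mul_haarEnergy_le hβ φ hΩ
        _ = _ := by rw [hK]; ring
    rw [BMOdNorm]
    refine (ENNReal.rpow_le_rpow h (by norm_num)).trans_eq ?_
    rw [← ENNReal.rpow_natCast, ← ENNReal.rpow_mul]
    norm_num
  refine ⟨summable_paraproductTerm hβ hf φ, ⟨Submodule.starProjection_apply_mem _ _, ?_⟩, hle⟩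
  exact hle.trans_lt (ENNReal.mul_lt_top (ENNReal.mul_lt_top ENNReal.coe_lt_top hφ) hf)
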